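/- **Setting.** Let $R$ be an integral domain and $G$ a finite abelian group such that $R$ contains a primitive $8|G|$-th root of unity. Let $\mathcal C$ be a monoidal near-group (Tambara–Yamagami) category over $R$ with underlying group $G$. That is, $\mathcal C$ is an additive $R$-linear monoidal category with $R$-bilinear tensor product; it has objects $g$ (for $g\in G$) and $m$ with $\operatorname{End}(s)=R\cdot 1_s\cong R$ for each of them and $\operatorname{Hom}(s,t)=0$ for any two different ones (the "simple objects"); every object is isomorphic to a finite direct sum of these; the unit object is isomorphic to the object $1\in G$; and $g\otimes h\cong gh$, $g\otimes m\cong m\cong m\otimes g$, $m\otimes m\cong\bigoplus_{g\in G}g$. Then $m$ is noninvertible if $G\neq1$; the degenerate case $G=1$ is allowed. Two braidings $c,c'$ on $\mathcal C$ are *equivalent* if there is an $R$-linear monoidal autoequivalence of $\mathcal C$ that fixes every simple object up to isomorphism and carries $c$ to $c'$. A *twist* compatible with a braiding $c$ is a natural automorphism $\theta$ of the identity functor with $\theta_{X\otimes Y}=(\theta_X\otimes\theta_Y)\,c_{Y,X}\,c_{X,Y}$ for all $X,Y$. The following scalars in $R$ are used. * $\chi(a,b)$, for $a,b\in G$: the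 associativity $\alpha_{a,m,b}:(am)b\to a(mb)$ is multiplication by $\chi(a,b)$ with respect to any basis elements of $\operatorname{Hom}(am,m)$ and $\operatorname{Hom}(mb,m)$. * $\tau$: the entry of $\alpha_{m,m,m}:(mm)m\to m(mm)$ from the summand $1m=m$ to the summand $m1=m$. * $\sigma_1(a)$, for $a\in G$ and a braiding $c$: $c_{a,m}:am\to ma$ is multiplication by $\sigma_1(a)$ with respect to basis elements of $\operatorname{Hom}(am,m)$ and $\operatorname{Hom}(ma,m)$ normalized so that $\alpha_{m,a,m}:(ma)m\to m(am)$ is the identity on the unit summand. * $\sigma_3(1)$, for a braiding $c$: $c_{m,m}:mm\to mm$ is multiplication by $\sigma_3(1)$ on the unit summand. **Theorem 1.2.** 1. $\mathcal C$ admits a braiding if and only if $G$ is an elementary abelian 2-group, i.e. $g^2=1$ for all $g\in G$. 2. Suppose that this is the case. Then the scalars $\chi(a,b)$, $\tau$ and, for every braiding, $\sigma_1(a)$ and $\sigma_3(1)$ exist. Let $n$ be the rank of $G$ (its minimal number of generators), let $g_1,\dots,g_n$ be any generators of $G$, and fix a choice of a square root $\sqrt x\in R$ of every square $x\in R$. Then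 each braiding determines a unique tuple of signs $(\delta_1,\dots,\delta_n,\epsilon)\in\{\pm1\}^{n+1}$ with $$\sigma_1(g_i)=\delta_i\sqrt{\chi(g_i,g_i)}\quad(1\le i\le n),\qquad \sigma_3(1)=\epsilon\sqrt{\tau\textstyle\sum_{a\in G}\sigma_1(a)},$$ all the elements under the root signs being squares in $R$. Two braidings have the same tuple if and only if they are equivalent, and every tuple in $\{\pm1\}^{n+1}$ occurs. So the equivalence classes of braidings on $\mathcal C$ are in bijection with $\{\pm1\}^{n+1}$. 3. For each braiding of $\mathcal C$ there are exactly two compatible twists. -/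

import Mathlib

open CategoryTheory CategoryTheory.Limits CategoryTheory.MonoidalCategory

universe w u v t

namespace NearGroup

/-- The family `s` exhibits the additive `R`-linear category `C` as a semisimple category over `R`:
the endomorphisms of each `s i` are exactly the scalar multiples of the identity (freely), there
are no nonzero morphisms between different members, and every object is a finite direct sum of
members of the family. -/
structure IsSemisimple (R : Type w) [CommRing R] {C : Type u} [Category.{v} C] [Preadditive C]
    [Linear R C] [HasFiniteBiproducts C] {ι : Type t} (s : ι → C) : Prop where
  end_eq : ∀ i, Function.Bijective fun r : R => r • 𝟙 (s i)
  hom_eq_zero : ∀ i j, i ≠ j → ∀ f : s i ⟶ s j, f = 0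
  exists_sum : ∀ X : C, ∃ (k : ℕ) (f : Fin k → ι), Nonempty (X ≅ ⨁ fun j => s (f j))

/-- A near-group (Tambara–Yamagami) structure with underlying finite group `G` on a monoidal
`R`-linear category `C`: `C` is semisimple, its simple objects are the `obj g`, for `g` in `G`, and
one further object `m`, with the fusion rules `g h = gh`, `g m = m = m g` and `m m = ⨁ g`.
(For `G ≠ 1` the fusion rules force `m` to be noninvertible; the degenerate case `G = 1`, in which
`m` is invertible, is not excluded.) -/
structure NearGroupCategory (R : Type w) [CommRing R] (G : Type t) [Group G] [Finite G]
    (C : Type u) [Category.{v} C] [Preadditive C] [Linear R C] [HasFiniteBiproducts C]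
    [MonoidalCategory C] where
  /-- the invertible simple objects -/
  obj : G → C
  /-- the remaining simple object -/
  m : C
  semisimple : IsSemisimple R (fun x : Option G => x.elim m obj)
  unit_iso : Nonempty (𝟙_ C ≅ obj 1)
  obj_tensor_obj : ∀ g h : G, Nonempty (obj g ⊗ obj h ≅ obj (g * h))
  obj_tensor_m : ∀ g : G, Nonempty (obj g ⊗ m ≅ m)
  m_tensor_obj : ∀ g : G, Nonempty (m ⊗ obj g ≅ m)
  m_tensor_m : Nonempty (m ⊗ m ≅ ⨁ obj)

/-- Every element of `G` has order dividing two. (For an abelian group this says that `G` is an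
elementary abelian 2-group.) -/
def IsElementaryTwo (G : Type t) [Group G] : Prop := ∀ g : G, g ^ 2 = 1

/-- A twist (balanced structure) compatible with a braiding `c`: a natural automorphism `θ` of the
identity functor with `θ_{X ⊗ Y} = (θ_X ⊗ θ_Y) ∘ c_{Y,X} ∘ c_{X,Y}`. -/
structure Twist {C : Type u} [Category.{v} C] [MonoidalCategory C] (c : BraidedCategory C) where
  θ : 𝟭 C ≅ 𝟭 C
  balance : ∀ X Y : C, θ.hom.app (X ⊗ Y) =
    (c.braiding X Y).hom ≫ (c.braiding Y X).hom ≫ (θ.hom.app X ⊗ₘ θ.hom.app Y)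

variable {R : Type w} [CommRing R] {G : Type t} [Group G] [Finite G]
  {C : Type u} [Category.{v} C] [Preadditive C] [Linear R C] [HasFiniteBiproducts C]
  [MonoidalCategory C]

/-- Two braidings on `C` are equivalent if there is an `R`-linear monoidal autoequivalence of `C`
that fixes each simple object up to isomorphism and carries the first braiding to the second. -/
def BraidingsEquivalent (N : NearGroupCategory R G C) (c c' : BraidedCategory C) : Prop :=
  ∃ (F : C ⥤ C) (_ : F.Monoidal) (_ : F.Additive), F.IsEquivalence ∧ F.Linear R ∧
    (∀ g : G, Nonempty (F.obj (N.obj g) ≅ N.obj g)) ∧ Nonempty (F.obj N.m ≅ N.m) ∧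
    ∀ X Y : C, Functor.LaxMonoidal.μ F X Y ≫ F.map (c.braiding X Y).hom =
      (c'.braiding (F.obj X) (F.obj Y)).hom ≫ Functor.LaxMonoidal.μ F Y X

/-- `x` is the scalar `χ(a, b)` by which the associator `(a m) b → a (m b)` acts, with respect to
any basis elements `l` of `Hom(a m, m)` and `r` of `Hom(m b, m)`. -/
def IsChi (N : NearGroupCategory R G C) (a b : G) (x : R) : Prop :=
  ∀ (l : N.obj a ⊗ N.m ⟶ N.m) (r : N.m ⊗ N.obj b ⟶ N.m),
    (α_ (N.obj a) N.m (N.obj b)).hom ≫ (N.obj a ◁ r) ≫ l = x • ((l ▷ N.obj b) ≫ r)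

/-- `x` is the scalar `τ`, the entry of the associator `(m m) m → m (m m)` at the summand
`1 m = m` of the source and the summand `m 1 = m` of the target. -/
def IsTau (N : NearGroupCategory R G C) (x : R) : Prop :=
  ∀ (i : 𝟙_ C ⟶ N.m ⊗ N.m) (p : N.m ⊗ N.m ⟶ 𝟙_ C), i ≫ p = 𝟙 (𝟙_ C) →
    (λ_ N.m).inv ≫ (i ▷ N.m) ≫ (α_ N.m N.m N.m).hom ≫ (N.m ◁ p) ≫ (ρ_ N.m).hom = x • 𝟙 N.m

/-- `x` is the scalar `σ₁(a)` by which the braiding `a m → m a` acts, with respect to basis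
elements `l` of `Hom(a m, m)` and `r` of `Hom(m a, m)` that are normalized so that the associator
`(m a) m → m (a m)` is the identity on the unit summand. -/
def IsSigmaOne (N : NearGroupCategory R G C) (c : BraidedCategory C) (a : G) (x : R) : Prop :=
  ∀ (l : N.obj a ⊗ N.m ⟶ N.m) (r : N.m ⊗ N.obj a ⟶ N.m),
    (∀ p : N.m ⊗ N.m ⟶ 𝟙_ C,
      (r ▷ N.m) ≫ p = (α_ N.m (N.obj a) N.m).hom ≫ (N.m ◁ l) ≫ p) →
    (c.braiding (N.obj a) N.m).hom ≫ r = x • l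

/-- `x` is the scalar `σ₃(1)` by which the braiding `m m → m m` acts on the unit summand. -/
def IsSigmaThree (N : NearGroupCategory R G C) (c : BraidedCategory C) (x : R) : Prop :=
  ∀ p : N.m ⊗ N.m ⟶ 𝟙_ C, (c.braiding N.m N.m).hom ≫ p = x • p

end NearGroup

set_option linter.unusedSectionVars false

/-!
A near-group category is multiplicity free: `u` occurs at most once in `s ⊗ t` for simple
`s, t, u`. Choosing projections and injections for all products (`NearGroup.FusionBasis`) turns its
associator, and any braiding, into families of scalars, the associativity symbols and the braiding
symbols; by semisimplicity, the pentagon and hexagon identities become identities between these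
scalars (`assocSymbol_pentagon`, `hexagon_of_braided`), every invertible solution of the hexagon
identities extends to a braiding (`braided`), and the symbols determine the braiding
(`braided_ext`).

After a rescaling of the basis the pentagons force the normal form of Tambara and Yamagami
(`IsAssocSymbol.exists_eq_normalForm`): a nondegenerate symmetric bicharacter `χ` and a scalar `τ`
with `τ² |G| = 1`. The scalars of the statement are read off from it (`chi_spec`, `tau_spec`,
`sigmaOne_spec`, `sigmaThree_spec`).

In normal form the hexagons of a braiding and of its inverse, with symbols `σ₀(a, b)` on `a b`,
`σ₁(a)` on `a m`, `σ₂(a)` on `m a` and `σ₃(a)` on the summand `a` of `m m`, amount to `σ₀ = χ`,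
`χ² = 1`, `σ₁(a)² = χ(a, a)`, `σ₁(a b) = σ₁(a) σ₁(b) χ(a, b)`, `σ₂ = σ₁`, `σ₃(a) = σ₃(1) σ₁(a)⁻¹`
and `σ₃(1)² = τ ∑ σ₁(a)` (`IsDatum.eq_braidForm_of_hexagon`, `IsBraidData.hexagon`). Since `χ` is
nondegenerate, `χ² = 1` makes `G` elementary abelian of exponent two. Conversely, for such `G` the
quadratic refinements `σ₁` of `χ` are determined by arbitrary square roots of `χ(gᵢ, gᵢ)` at the
elements of a basis (`IsDatum.exists_isQuadratic`), and `σ₃(1)` is an arbitrary square root of the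
normalized Gauss sum `τ ∑ σ₁(a)`. The roots exist: `χ(gᵢ, gᵢ) = ±1`, and the square of the Gauss
sum is a value of `σ₁`, so that the sum is a root of unity of order dividing `4|G|`
(`IsQuadratic.isSquare_gauss`).

Since `σ₁` and `σ₃(1)` are invariant under equivalence (`IsSigmaOne.of_equivalent`,
`IsSigmaThree.of_equivalent`) and determine the braiding, equivalent braidings are even equal, and
the signs of the square roots classify them. A twist acts on `a` as `χ(a, a)`, and on `m` as a
square root of `σ₃(1)⁻²`, of which there are two, because `2 ≠ 0` in `R`
(`FusionBasis.card_twist`).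
-/

namespace NearGroup

/-! ### Morphisms of a semisimple category -/

section Semisimple

variable {R : Type w} [CommRing R] {C : Type u} [Category.{v} C] [Preadditive C] [Linear R C]
  [HasFiniteBiproducts C] {ι : Type t} {S : ι → C}

namespace IsSemisimple

/-- The scalar by which an endomorphism of a simple object acts. -/
noncomputable def scalar (h : IsSemisimple R S) {i : ι} (f : S i ⟶ S i) : R :=
  (Equiv.ofBijective _ (h.end_eq i)).symm f

lemma scalar_smul (h : IsSemisimple R S) {i : ι} (f : S i ⟶ S i) :
    h.scalar f • 𝟙 (S i) = f :=
  (Equiv.ofBijective _ (h.end_eq i)).apply_symm_apply f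

lemma smul_id_injective (h : IsSemisimple R S) {i : ι} {x y : R}
    (e : x • 𝟙 (S i) = y • 𝟙 (S i)) : x = y :=
  (h.end_eq i).1 e

lemma scalar_zero (h : IsSemisimple R S) {i : ι} : h.scalar (0 : S i ⟶ S i) = 0 :=
  h.smul_id_injective (i := i) (by rw [scalar_smul, zero_smul])

lemma scalar_smul_id (h : IsSemisimple R S) {i : ι} (x : R) : h.scalar (x • 𝟙 (S i)) = x :=
  h.smul_id_injective (i := i) (by rw [scalar_smul])

/-- The identity of every object is a finite sum of endomorphisms that factor through simple
objects. Only this consequence of `exists_sum` is needed below. -/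
lemma exists_resolution (h : IsSemisimple R S) (X : C) :
    ∃ (k : ℕ) (f : Fin k → ι) (p : ∀ j, X ⟶ S (f j)) (q : ∀ j, S (f j) ⟶ X),
      ∑ j, p j ≫ q j = 𝟙 X := by
  obtain ⟨k, f, ⟨e⟩⟩ := h.exists_sum X
  let B := fun j => S (f j)
  refine ⟨k, f, fun j => e.hom ≫ biproduct.π B j, fun j => biproduct.ι B j ≫ e.inv, ?_⟩
  have : ∑ j, (e.hom ≫ biproduct.π B j) ≫ biproduct.ι B j ≫ e.inv =
      e.hom ≫ (∑ j, biproduct.π B j ≫ biproduct.ι B j) ≫ e.inv := by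
    simp only [Preadditive.sum_comp, Preadditive.comp_sum, Category.assoc]
  rw [this, biproduct.total, Category.id_comp, e.hom_inv_id]

lemma hom_ext (h : IsSemisimple R S) {A X : C} {f g : A ⟶ X}
    (e : ∀ (s : ι) (x : X ⟶ S s), f ≫ x = g ≫ x) : f = g := by
  obtain ⟨k, a, p, q, hpq⟩ := h.exists_resolution X
  rw [← Category.comp_id f, ← Category.comp_id g, ← hpq]
  simp only [Preadditive.comp_sum, ← Category.assoc, e]

/-- The simple objects along which the chosen decomposition of `X` runs. -/
noncomputable def index (h : IsSemisimple R S) (X : C) :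
    Fin (h.exists_resolution X).choose → ι :=
  (h.exists_resolution X).choose_spec.choose

/-- The projections of the chosen decomposition of `X`. -/
noncomputable def proj (h : IsSemisimple R S) (X : C) (j) : X ⟶ S (h.index X j) :=
  (h.exists_resolution X).choose_spec.choose_spec.choose j

/-- The injections of the chosen decomposition of `X`. -/
noncomputable def incl (h : IsSemisimple R S) (X : C) (j) : S (h.index X j) ⟶ X :=
  (h.exists_resolution X).choose_spec.choose_spec.choose_spec.choose j

lemma sum_proj_incl (h : IsSemisimple R S) (X : C) :
    ∑ j, h.proj X j ≫ h.incl X j = 𝟙 X :=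
  (h.exists_resolution X).choose_spec.choose_spec.choose_spec.choose_spec

/-- The endomorphism of `X` that acts on the `s`-isotypic part as the scalar `x s`. -/
noncomputable def diag (h : IsSemisimple R S) (x : ι → R) (X : C) : X ⟶ X :=
  ∑ j, x (h.index X j) • (h.proj X j ≫ h.incl X j)

lemma diag_comp (h : IsSemisimple R S) (x : ι → R) {X : C} {s : ι} (f : X ⟶ S s) :
    h.diag x X ≫ f = x s • f := by
  have key : ∀ j, x (h.index X j) • (h.incl X j ≫ f) = x s • (h.incl X j ≫ f) := by
    intro j
    by_cases hj : h.index X j = s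
    · exact congrArg (fun i => x i • (h.incl X j ≫ f)) hj
    · rw [h.hom_eq_zero _ _ hj (h.incl X j ≫ f), smul_zero, smul_zero]
  calc h.diag x X ≫ f = ∑ j, h.proj X j ≫ (x (h.index X j) • (h.incl X j ≫ f)) := by
        simp only [diag, Preadditive.sum_comp, Linear.smul_comp, Category.assoc, Linear.comp_smul]
    _ = x s • ((∑ j, h.proj X j ≫ h.incl X j) ≫ f) := by
        simp only [key, Linear.comp_smul, Preadditive.sum_comp, Finset.smul_sum, Category.assoc]
    _ = x s • f := by rw [sum_proj_incl, Category.id_comp]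

lemma diag_naturality (h : IsSemisimple R S) (x : ι → R) {X Y : C} (f : X ⟶ Y) :
    f ≫ h.diag x Y = h.diag x X ≫ f := by
  refine h.hom_ext fun s y => ?_
  rw [Category.assoc, Category.assoc, diag_comp, diag_comp, Linear.comp_smul]

section Monoidal

variable [MonoidalCategory C] [MonoidalPreadditive C]

lemma hom_ext_tensor (h : IsSemisimple R S) {A X Y : C} {f g : A ⟶ X ⊗ Y}
    (e : ∀ (s t : ι) (x : X ⟶ S s) (y : Y ⟶ S t), f ≫ (x ⊗ₘ y) = g ≫ (x ⊗ₘ y)) : f = g := by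
  have key : 𝟙 (X ⊗ Y) = ∑ j, ∑ k, (h.proj X j ⊗ₘ h.proj Y k) ≫ (h.incl X j ⊗ₘ h.incl Y k) := by
    simp only [tensorHom_comp_tensorHom]
    simp only [← tensor_sum, ← sum_tensor, sum_proj_incl, id_tensorHom_id]
  rw [← Category.comp_id f, ← Category.comp_id g, key]
  simp only [Preadditive.comp_sum, ← Category.assoc, e]

lemma hom_ext_tensor₃ (h : IsSemisimple R S) {A X Y Z : C} {f g : A ⟶ X ⊗ (Y ⊗ Z)}
    (e : ∀ (s t r : ι) (x : X ⟶ S s) (y : Y ⟶ S t) (z : Z ⟶ S r),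
      f ≫ (x ⊗ₘ (y ⊗ₘ z)) = g ≫ (x ⊗ₘ (y ⊗ₘ z))) : f = g := by
  have key : 𝟙 (X ⊗ (Y ⊗ Z)) = ∑ i, ∑ j, ∑ k,
      (h.proj X i ⊗ₘ (h.proj Y j ⊗ₘ h.proj Z k)) ≫
        (h.incl X i ⊗ₘ (h.incl Y j ⊗ₘ h.incl Z k)) := by
    simp only [tensorHom_comp_tensorHom]
    simp only [← tensor_sum, ← sum_tensor, sum_proj_incl, id_tensorHom_id]
  rw [← Category.comp_id f, ← Category.comp_id g, key]
  simp only [Preadditive.comp_sum, ← Category.assoc, e]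

variable [MonoidalLinear R C]

lemma smul_tensorHom (r : R) {X Y X' Y' : C} (f : X ⟶ Y) (g : X' ⟶ Y') :
    (r • f) ⊗ₘ g = r • (f ⊗ₘ g) := by
  simp [MonoidalCategory.tensorHom_def]

lemma tensorHom_smul (r : R) {X Y X' Y' : C} (f : X ⟶ Y) (g : X' ⟶ Y') :
    f ⊗ₘ (r • g) = r • (f ⊗ₘ g) := by
  simp [MonoidalCategory.tensorHom_def]

/-- Naturality is automatic for families of morphisms indexed by pairs of simple objects. -/
lemma simple_naturality (h : IsSemisimple R S) (c : ∀ s t, S s ⊗ S t ⟶ S t ⊗ S s)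
    {s s' t t' : ι} (f : S s ⟶ S s') (g : S t ⟶ S t') :
    c s t ≫ (g ⊗ₘ f) = (f ⊗ₘ g) ≫ c s' t' := by
  by_cases hs : s = s'
  · by_cases ht : t = t'
    · subst hs ht
      rw [← h.scalar_smul f, ← h.scalar_smul g]
      simp only [smul_tensorHom, tensorHom_smul, Linear.comp_smul, Linear.smul_comp,
        id_tensorHom_id, Category.comp_id, Category.id_comp]
      rw [smul_comm]
    · rw [h.hom_eq_zero _ _ ht g]; simp
  · rw [h.hom_eq_zero _ _ hs f]; simp

/-- The natural extension to all objects of a family of morphisms `S s ⊗ S t ⟶ S t ⊗ S s`. -/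
noncomputable def extend (h : IsSemisimple R S) (c : ∀ s t, S s ⊗ S t ⟶ S t ⊗ S s) (X Y : C) :
    X ⊗ Y ⟶ Y ⊗ X :=
  ∑ j, ∑ k, (h.proj X j ⊗ₘ h.proj Y k) ≫ c _ _ ≫ (h.incl Y k ⊗ₘ h.incl X j)

lemma extend_comp (h : IsSemisimple R S) (c : ∀ s t, S s ⊗ S t ⟶ S t ⊗ S s) {X Y : C} {s t : ι}
    (x : X ⟶ S s) (y : Y ⟶ S t) :
    h.extend c X Y ≫ (y ⊗ₘ x) = (x ⊗ₘ y) ≫ c s t := by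
  calc h.extend c X Y ≫ (y ⊗ₘ x)
      = ∑ j, ∑ k, ((h.proj X j ≫ h.incl X j) ≫ x ⊗ₘ (h.proj Y k ≫ h.incl Y k) ≫ y) ≫ c s t := by
        simp only [extend, Preadditive.sum_comp, Category.assoc, tensorHom_comp_tensorHom,
          h.simple_naturality c, tensorHom_comp_tensorHom_assoc]
    _ = (x ⊗ₘ y) ≫ c s t := by
        simp only [← Preadditive.sum_comp, ← tensor_sum, ← sum_tensor, sum_proj_incl,
          Category.id_comp]

lemma extend_self (h : IsSemisimple R S) (c : ∀ s t, S s ⊗ S t ⟶ S t ⊗ S s) (s t : ι) :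
    h.extend c (S s) (S t) = c s t := by
  simpa using h.extend_comp c (𝟙 (S s)) (𝟙 (S t))

lemma extend_naturality (h : IsSemisimple R S) (c : ∀ s t, S s ⊗ S t ⟶ S t ⊗ S s)
    {X X' Y Y' : C} (f : X ⟶ X') (g : Y ⟶ Y') :
    (f ⊗ₘ g) ≫ h.extend c X' Y' = h.extend c X Y ≫ (g ⊗ₘ f) := by
  refine h.hom_ext_tensor fun s t x y => ?_
  simp only [Category.assoc, extend_comp, tensorHom_comp_tensorHom, tensorHom_comp_tensorHom_assoc]

lemma extend_comp_extend (h : IsSemisimple R S) {c d : ∀ s t, S s ⊗ S t ⟶ S t ⊗ S s}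
    (hcd : ∀ s t, c s t ≫ d t s = 𝟙 _) (X Y : C) :
    h.extend c X Y ≫ h.extend d Y X = 𝟙 _ := by
  refine h.hom_ext_tensor fun s t x y => ?_
  rw [Category.assoc, extend_comp, ← Category.assoc, extend_comp, Category.assoc, hcd]
  simp

/-- The forward hexagon holds for all objects if it holds for the simple ones: composing with
morphisms to simple objects moves it there, by naturality. -/
lemma extend_hexagon (h : IsSemisimple R S) {c : ∀ s t, S s ⊗ S t ⟶ S t ⊗ S s}
    (hc : ∀ s t r, (α_ (S s) (S t) (S r)).hom ≫ h.extend c (S s) (S t ⊗ S r) ≫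
      (α_ (S t) (S r) (S s)).hom =
      (c s t ▷ S r) ≫ (α_ (S t) (S s) (S r)).hom ≫ (S t ◁ c s r)) (X Y Z : C) :
    (α_ X Y Z).hom ≫ h.extend c X (Y ⊗ Z) ≫ (α_ Y Z X).hom =
      (h.extend c X Y ▷ Z) ≫ (α_ Y X Z).hom ≫ (Y ◁ h.extend c X Z) := by
  refine h.hom_ext_tensor₃ fun s t r y z x => ?_
  have h1 : (α_ X Y Z).hom ≫ (x ⊗ₘ (y ⊗ₘ z)) = ((x ⊗ₘ y) ⊗ₘ z) ≫ (α_ _ _ _).hom := by simp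
  have h2 : (α_ Y Z X).hom ≫ (y ⊗ₘ (z ⊗ₘ x)) = ((y ⊗ₘ z) ⊗ₘ x) ≫ (α_ _ _ _).hom := by simp
  have h3 : (α_ Y X Z).hom ≫ (y ⊗ₘ (x ⊗ₘ z)) = ((y ⊗ₘ x) ⊗ₘ z) ≫ (α_ _ _ _).hom := by simp
  have h4 : Y ◁ h.extend c X Z ≫ (y ⊗ₘ (z ⊗ₘ x)) = (y ⊗ₘ (x ⊗ₘ z)) ≫ S s ◁ c r t := by
    rw [← id_tensorHom, ← id_tensorHom, tensorHom_comp_tensorHom, tensorHom_comp_tensorHom,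
      extend_comp]; simp
  have h5 : h.extend c X Y ▷ Z ≫ ((y ⊗ₘ x) ⊗ₘ z) = ((x ⊗ₘ y) ⊗ₘ z) ≫ c r s ▷ S t := by
    rw [← tensorHom_id, ← tensorHom_id, tensorHom_comp_tensorHom, tensorHom_comp_tensorHom,
      extend_comp]; simp
  rw [Category.assoc, Category.assoc, Category.assoc, Category.assoc, h2, h4,
    ← Category.assoc (h.extend c X (Y ⊗ Z)), ← extend_naturality, Category.assoc,
    ← Category.assoc, h1, Category.assoc, hc, ← Category.assoc (α_ Y X Z).hom, h3,
    Category.assoc, ← Category.assoc (h.extend c X Y ▷ Z), h5, Category.assoc]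

end Monoidal

end IsSemisimple

end Semisimple

/-! ### Multiplicity-free fusion bases and their associativity and braiding symbols -/

section FusionBasis

variable {R : Type w} [CommRing R] {C : Type u} [Category.{v} C] [Preadditive C] [Linear R C]
  [HasFiniteBiproducts C] [MonoidalCategory C] {I : Type t} [Fintype I]

/-- A decomposition of all products `S s ⊗ S t` of simple objects into simple objects, in which
`S u` occurs once if `N s t u` and not at all otherwise; `v` are the projections, `w` the
injections. They are defined for all triples, and zero on the inadmissible ones, so that sums may
run over the whole index type. -/
structure FusionBasis (S : I → C) (N : I → I → I → Prop) where
  /-- the projections -/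
  v : ∀ s t u, S s ⊗ S t ⟶ S u
  /-- the injections -/
  w : ∀ s t u, S u ⟶ S s ⊗ S t
  v_eq_zero : ∀ s t u, ¬ N s t u → v s t u = 0
  w_eq_zero : ∀ s t u, ¬ N s t u → w s t u = 0
  w_v : ∀ s t u, N s t u → w s t u ≫ v s t u = 𝟙 _
  sum_v_w : ∀ s t, ∑ u, v s t u ≫ w s t u = 𝟙 _

/-- The (forward) hexagon identity for the symbols `f` of the associativity and `b` of a braiding:
the entry from the path `(s t) r → p' r → u` to the path `t (r s) → t q → u`. -/
def Hexagon (f : I → I → I → I → I → I → R) (b : I → I → I → R) : Prop :=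
  ∀ s t r u p' q, ∑ p, f s t r u p' p * b s p u * f t r s u p q =
    b s t p' * f t s r u p' q * b s r q

namespace FusionBasis

variable {S : I → C} {N : I → I → I → Prop}

lemma hom_ext (V : FusionBasis S N) {A : C} {s t : I} {f g : A ⟶ S s ⊗ S t}
    (e : ∀ u, f ≫ V.v s t u = g ≫ V.v s t u) : f = g := by
  rw [← Category.comp_id f, ← Category.comp_id g, ← V.sum_v_w]
  simp only [Preadditive.comp_sum, ← Category.assoc, e]

variable [MonoidalPreadditive C]

lemma hom_ext₃ (V : FusionBasis S N) {A : C} {s t r : I} {f g : A ⟶ S s ⊗ (S t ⊗ S r)}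
    (e : ∀ q u, f ≫ (S s ◁ V.v t r q) ≫ V.v s q u = g ≫ (S s ◁ V.v t r q) ≫ V.v s q u) :
    f = g := by
  have h : ∀ q, f ≫ (S s ◁ V.v t r q) = g ≫ (S s ◁ V.v t r q) := fun q =>
    V.hom_ext fun u => by simpa using e q u
  rw [← Category.comp_id f, ← Category.comp_id g, ← whiskerLeft_id, ← V.sum_v_w]
  simp only [whiskerLeft_sum, Preadditive.comp_sum, MonoidalCategory.whiskerLeft_comp,
    ← Category.assoc, h]

variable [MonoidalLinear R C]

lemma eq_scalar_smul (V : FusionBasis S N) (h : IsSemisimple R S) {s t u : I}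
    (f : S s ⊗ S t ⟶ S u) : f = h.scalar (V.w s t u ≫ f) • V.v s t u := by
  conv_lhs => rw [← Category.id_comp f, ← V.sum_v_w, Preadditive.sum_comp]
  rw [Fintype.sum_eq_single u]
  · rw [Category.assoc, ← h.scalar_smul (V.w s t u ≫ f), Linear.comp_smul, Category.comp_id,
      h.scalar_smul]
  · intro u' hu'
    rw [Category.assoc, h.hom_eq_zero _ _ hu' (V.w s t u' ≫ f), comp_zero]

lemma smul_v_injective (V : FusionBasis S N) (h : IsSemisimple R S) {s t u : I} (hN : N s t u)
    {x y : R} (e : x • V.v s t u = y • V.v s t u) : x = y := by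
  have := congrArg (fun f => V.w s t u ≫ f) e
  simp only [Linear.comp_smul, V.w_v _ _ _ hN] at this
  exact h.smul_id_injective this

/-- The braiding symbol `R^{st}_u` of a morphism `c : S s ⊗ S t ⟶ S t ⊗ S s`. -/
noncomputable def braidSymbol (V : FusionBasis S N) (h : IsSemisimple R S) {s t : I}
    (c : S s ⊗ S t ⟶ S t ⊗ S s) (u : I) : R :=
  h.scalar (V.w s t u ≫ c ≫ V.v t s u)

lemma comp_v (V : FusionBasis S N) (h : IsSemisimple R S) {s t : I}
    (c : S s ⊗ S t ⟶ S t ⊗ S s) (u : I) :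
    c ≫ V.v t s u = V.braidSymbol h c u • V.v s t u :=
  V.eq_scalar_smul h _

/-- The associativity symbol `F^{str}_u` at the intermediate objects `p` (of `s t`) and `q` (of
`t r`). -/
noncomputable def assocSymbol (V : FusionBasis S N) (h : IsSemisimple R S) (s t r u p q : I) : R :=
  h.scalar (V.w p r u ≫ (V.w s t p ▷ S r) ≫ (α_ (S s) (S t) (S r)).hom ≫
    (S s ◁ V.v t r q) ≫ V.v s q u)

lemma assocSymbol_eq_zero (V : FusionBasis S N) (h : IsSemisimple R S) {s t r u p q : I}
    (hN : ¬ (N s t p ∧ N p r u ∧ N t r q ∧ N s q u)) : V.assocSymbol h s t r u p q = 0 := by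
  unfold assocSymbol
  by_cases h1 : N s t p
  · by_cases h2 : N p r u
    · by_cases h3 : N t r q
      · have h4 : ¬ N s q u := fun h4 => hN ⟨h1, h2, h3, h4⟩
        simp [V.v_eq_zero _ _ _ h4, h.scalar_zero]
      · simp [V.v_eq_zero _ _ _ h3, h.scalar_zero]
    · simp [V.w_eq_zero _ _ _ h2, h.scalar_zero]
  · simp [V.w_eq_zero _ _ _ h1, h.scalar_zero]

/-- Morphisms `(S s ⊗ S t) ⊗ S r ⟶ S u` are determined by their components. -/
lemma eq_sum_scalar_smul (V : FusionBasis S N) (h : IsSemisimple R S) {s t r u : I}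
    (f : (S s ⊗ S t) ⊗ S r ⟶ S u) :
    f = ∑ p, h.scalar (V.w p r u ≫ (V.w s t p ▷ S r) ≫ f) • ((V.v s t p ▷ S r) ≫ V.v p r u) := by
  conv_lhs => rw [← Category.id_comp f, ← id_whiskerRight, ← V.sum_v_w, sum_whiskerRight,
    Preadditive.sum_comp]
  refine Finset.sum_congr rfl fun p _ => ?_
  rw [comp_whiskerRight, Category.assoc, ← Linear.comp_smul,
    ← V.eq_scalar_smul h ((V.w s t p ▷ S r) ≫ f)]

lemma assoc_comp (V : FusionBasis S N) (h : IsSemisimple R S) (s t r u q : I) :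
    (α_ (S s) (S t) (S r)).hom ≫ (S s ◁ V.v t r q) ≫ V.v s q u =
      ∑ p, V.assocSymbol h s t r u p q • ((V.v s t p ▷ S r) ≫ V.v p r u) :=
  V.eq_sum_scalar_smul h _

lemma assoc_comp_single (V : FusionBasis S N) (h : IsSemisimple R S) (s t r u p q : I)
    (hp : ∀ p', p' ≠ p → V.assocSymbol h s t r u p' q = 0) :
    (α_ (S s) (S t) (S r)).hom ≫ (S s ◁ V.v t r q) ≫ V.v s q u =
      V.assocSymbol h s t r u p q • ((V.v s t p ▷ S r) ≫ V.v p r u) := by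
  rw [V.assoc_comp h, Fintype.sum_eq_single p fun p' hp' => by rw [hp p' hp', zero_smul]]

/-- The paths `(s t) r → p r → u` through admissible `p` are linearly independent. -/
lemma path_ext (V : FusionBasis S N) (h : IsSemisimple R S) {s t r u : I} {x y : I → R}
    (e : ∑ p, x p • ((V.v s t p ▷ S r) ≫ V.v p r u) =
      ∑ p, y p • ((V.v s t p ▷ S r) ≫ V.v p r u)) (p : I) (h1 : N s t p) (h2 : N p r u) :
    x p = y p := by
  have key : ∀ z : I → R, V.w p r u ≫ (V.w s t p ▷ S r) ≫
      ∑ p, z p • ((V.v s t p ▷ S r) ≫ V.v p r u) = z p • 𝟙 _ := by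
    intro z
    simp only [Preadditive.comp_sum, Linear.comp_smul]
    rw [Fintype.sum_eq_single p]
    · rw [← comp_whiskerRight_assoc, V.w_v _ _ _ h1, id_whiskerRight, Category.id_comp,
        V.w_v _ _ _ h2]
    · intro p' hp'
      rw [← comp_whiskerRight_assoc, h.hom_eq_zero _ _ hp'.symm (V.w s t p ≫ _)]
      simp
  have := congrArg (fun f => V.w p r u ≫ (V.w s t p ▷ S r) ≫ f) e
  simp only [key] at this
  exact h.smul_id_injective this

/-- The pentagon identity in coordinates: the entry from `((s t) r) z → (p r) z → x z → u` to
`s (t (r z)) → s (t a) → s b → u`. -/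
lemma assocSymbol_pentagon (V : FusionBasis S N) (h : IsSemisimple R S)
    (s t r z u a b p x : I) (h1 : N s t p) (h2 : N p r x) (h3 : N x z u) :
    V.assocSymbol h s t a u p b * V.assocSymbol h p r z u x a =
      ∑ c, V.assocSymbol h t r z b c a * V.assocSymbol h s c z u x b *
        V.assocSymbol h s t r x p c := by
  have hl : (α_ (S s ⊗ S t) (S r) (S z)).hom ≫ (α_ (S s) (S t) (S r ⊗ S z)).hom ≫
      (S s ◁ (S t ◁ V.v r z a)) ≫ (S s ◁ V.v t a b) ≫ V.v s b u =
      ∑ p, ∑ x, (V.assocSymbol h s t a u p b * V.assocSymbol h p r z u x a) •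
        ((V.v s t p ▷ S r) ▷ S z ≫ V.v p r x ▷ S z ≫ V.v x z u) := by
    have e1 : (α_ (S s) (S t) (S r ⊗ S z)).hom ≫ (S s ◁ (S t ◁ V.v r z a)) =
      ((S s ⊗ S t) ◁ V.v r z a) ≫ (α_ _ _ _).hom := by simp
    rw [← Category.assoc (α_ (S s) (S t) (S r ⊗ S z)).hom, e1, Category.assoc, V.assoc_comp h]
    simp only [Preadditive.comp_sum, Linear.comp_smul]
    refine Finset.sum_congr rfl fun p _ => ?_
    have e2 : (α_ (S s ⊗ S t) (S r) (S z)).hom ≫ ((S s ⊗ S t) ◁ V.v r z a) ≫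
        V.v s t p ▷ S a ≫ V.v p a u = (V.v s t p ▷ S r) ▷ S z ≫ (α_ _ _ _).hom ≫
        (S p ◁ V.v r z a) ≫ V.v p a u := by
      rw [whisker_exchange_assoc]; simp
    rw [e2, V.assoc_comp h]
    simp only [Preadditive.comp_sum, Linear.comp_smul, Finset.smul_sum, smul_smul]
  have hr : (α_ (S s) (S t) (S r)).hom ▷ S z ≫ (α_ (S s) (S t ⊗ S r) (S z)).hom ≫
      S s ◁ (α_ (S t) (S r) (S z)).hom ≫
      (S s ◁ (S t ◁ V.v r z a)) ≫ (S s ◁ V.v t a b) ≫ V.v s b u =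
      ∑ p, ∑ x, (∑ c, V.assocSymbol h t r z b c a * V.assocSymbol h s c z u x b *
        V.assocSymbol h s t r x p c) •
        ((V.v s t p ▷ S r) ▷ S z ≫ V.v p r x ▷ S z ≫ V.v x z u) := by
    have e1 : S s ◁ (α_ (S t) (S r) (S z)).hom ≫
      (S s ◁ (S t ◁ V.v r z a)) ≫ (S s ◁ V.v t a b) ≫ V.v s b u =
      ∑ c, V.assocSymbol h t r z b c a •
        (S s ◁ (V.v t r c ▷ S z) ≫ S s ◁ V.v c z b ≫ V.v s b u) := by
      rw [← MonoidalCategory.whiskerLeft_comp_assoc, ← MonoidalCategory.whiskerLeft_comp_assoc,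
        Category.assoc, V.assoc_comp h, whiskerLeft_sum, Preadditive.sum_comp]
      simp
    have e2 : ∀ c, (α_ (S s) (S t) (S r)).hom ▷ S z ≫ (α_ (S s) (S t ⊗ S r) (S z)).hom ≫
        (S s ◁ (V.v t r c ▷ S z) ≫ S s ◁ V.v c z b ≫ V.v s b u) =
        ∑ x, ∑ p, (V.assocSymbol h s c z u x b * V.assocSymbol h s t r x p c) •
        ((V.v s t p ▷ S r) ▷ S z ≫ V.v p r x ▷ S z ≫ V.v x z u) := by
      intro c
      have e3 : (α_ (S s) (S t ⊗ S r) (S z)).hom ≫ (S s ◁ (V.v t r c ▷ S z)) =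
        (S s ◁ V.v t r c) ▷ S z ≫ (α_ _ _ _).hom := by simp
      rw [← Category.assoc (α_ (S s) (S t ⊗ S r) (S z)).hom, e3, Category.assoc, V.assoc_comp h]
      simp only [Preadditive.comp_sum, Linear.comp_smul]
      refine Finset.sum_congr rfl fun x _ => ?_
      rw [← comp_whiskerRight_assoc, ← comp_whiskerRight_assoc, Category.assoc, V.assoc_comp h,
        sum_whiskerRight, Preadditive.sum_comp, Finset.smul_sum]
      refine Finset.sum_congr rfl fun p _ => ?_
      simp [smul_smul]
    rw [e1]
    simp only [Preadditive.comp_sum, Linear.comp_smul, e2]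
    simp only [Finset.smul_sum, Finset.sum_smul, smul_smul]
    rw [Finset.sum_congr rfl fun c _ => Finset.sum_comm, Finset.sum_comm]
    refine Finset.sum_congr rfl fun p _ => ?_
    rw [Finset.sum_comm]
    simp only [mul_assoc]
  have key : ∀ y : I → I → R, V.w x z u ≫ (V.w p r x ▷ S z) ≫ ((V.w s t p ▷ S r) ▷ S z) ≫
      ∑ p, ∑ x, y p x • ((V.v s t p ▷ S r) ▷ S z ≫ V.v p r x ▷ S z ≫ V.v x z u) =
      y p x • 𝟙 _ := by
    intro y
    simp only [Preadditive.comp_sum, Linear.comp_smul]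
    rw [Fintype.sum_eq_single p, Fintype.sum_eq_single x]
    · simp only [← comp_whiskerRight_assoc, V.w_v _ _ _ h1, id_whiskerRight, Category.id_comp,
        V.w_v _ _ _ h2, V.w_v _ _ _ h3]
    · intro x' hx'
      simp only [← comp_whiskerRight_assoc, V.w_v _ _ _ h1, id_whiskerRight, Category.id_comp]
      rw [h.hom_eq_zero _ _ hx'.symm (V.w p r x ≫ _)]
      simp
    · intro p' hp'
      refine Finset.sum_eq_zero fun x' _ => ?_
      simp only [← comp_whiskerRight_assoc]
      rw [h.hom_eq_zero _ _ hp'.symm (V.w s t p ≫ _)]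
      simp
  have e := hr
  rw [pentagon_assoc, hl] at e
  have := congrArg (fun f => V.w x z u ≫ (V.w p r x ▷ S z) ≫ ((V.w s t p ▷ S r) ▷ S z) ≫ f) e
  simp only [key] at this
  exact h.smul_id_injective this

/-- A block of size one of the associativity symbols is a unit, its inverse being the corresponding
entry of the inverse associator. -/
lemma isUnit_assocSymbol (V : FusionBasis S N) (h : IsSemisimple R S) {s t r u p q : I}
    (h1 : N s t p) (h2 : N p r u) (hp : ∀ p', N s t p' → N p' r u → p' = p)
    (hq : ∀ q', N t r q' → N s q' u → q' = q) : IsUnit (V.assocSymbol h s t r u p q) := by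
  have e := V.assoc_comp_single h s t r u p q fun p' hp' =>
    V.assocSymbol_eq_zero h fun hN => hp' (hp p' hN.1 hN.2.1)
  -- the coefficient of the inverse associator
  let y : R := h.scalar (V.w s q u ≫ (S s ◁ V.w t r q) ≫ (α_ _ _ _).inv ≫
    (V.v s t p ▷ S r) ≫ V.v p r u)
  have e' : (α_ _ _ _).inv ≫ (V.v s t p ▷ S r) ≫ V.v p r u =
      y • ((S s ◁ V.v t r q) ≫ V.v s q u) := by
    rw [← Category.id_comp ((α_ (S s) (S t) (S r)).inv ≫ _), ← whiskerLeft_id, ← V.sum_v_w,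
      whiskerLeft_sum, Preadditive.sum_comp, Fintype.sum_eq_single q]
    · rw [MonoidalCategory.whiskerLeft_comp, Category.assoc, ← Linear.comp_smul,
        ← V.eq_scalar_smul h]
    · intro q' hq'
      rw [MonoidalCategory.whiskerLeft_comp, Category.assoc]
      by_cases h3 : N t r q'
      · rw [V.eq_scalar_smul h (S s ◁ V.w t r q' ≫ _),
          V.v_eq_zero s q' u fun h4 => hq' (hq _ h3 h4), smul_zero, comp_zero]
      · rw [V.v_eq_zero _ _ _ h3]; simp
  refine IsUnit.of_mul_eq_one y ?_
  have e2 : (V.v s t p ▷ S r) ≫ V.v p r u =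
      (y * V.assocSymbol h s t r u p q) • ((V.v s t p ▷ S r) ≫ V.v p r u) := by
    rw [mul_smul, ← e, ← Linear.comp_smul, ← e', Iso.hom_inv_id_assoc]
  have e3 := congrArg (fun f => V.w p r u ≫ (V.w s t p ▷ S r) ≫ f) e2
  simp only [Linear.comp_smul, ← comp_whiskerRight_assoc, V.w_v _ _ _ h1, id_whiskerRight,
    Category.id_comp, V.w_v _ _ _ h2] at e3
  rw [mul_comm]
  exact h.smul_id_injective (by rw [one_smul]; exact e3.symm)

/-- The change of basis that multiplies the projection `v s t u` by the unit `l s t u`. -/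
def rescale (V : FusionBasis S N) (l : I → I → I → Rˣ) : FusionBasis S N where
  v s t u := (l s t u : R) • V.v s t u
  w s t u := ((l s t u)⁻¹ : Rˣ).val • V.w s t u
  v_eq_zero s t u hN := by rw [V.v_eq_zero _ _ _ hN, smul_zero]
  w_eq_zero s t u hN := by rw [V.w_eq_zero _ _ _ hN, smul_zero]
  w_v s t u hN := by
    rw [Linear.smul_comp, Linear.comp_smul, smul_smul, V.w_v _ _ _ hN, Units.inv_mul, one_smul]
  sum_v_w s t := by
    simp only [Linear.smul_comp, Linear.comp_smul, smul_smul, Units.inv_mul, one_smul, V.sum_v_w]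

lemma assocSymbol_rescale (V : FusionBasis S N) (h : IsSemisimple R S) (l : I → I → I → Rˣ)
    (s t r u p q : I) : (V.rescale l).assocSymbol h s t r u p q =
      ((l t r q * l s q u * (l s t p)⁻¹ * (l p r u)⁻¹ : Rˣ) : R) * V.assocSymbol h s t r u p q := by
  refine h.smul_id_injective (i := u) ?_
  rw [mul_smul, assocSymbol, assocSymbol, h.scalar_smul, h.scalar_smul]
  simp only [rescale, MonoidalLinear.whiskerLeft_smul, MonoidalLinear.smul_whiskerRight,
    Linear.comp_smul, Linear.smul_comp, smul_smul]
  congr 1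
  push_cast
  ring

/-- The hexagon for three simple objects in coordinates. The morphism `e` stands for the component
at `S s` and `S t ⊗ S r`, of which only naturality in the second argument matters. -/
lemma hexagon_iff (V : FusionBasis S N) (h : IsSemisimple R S)
    (c : ∀ s t, S s ⊗ S t ⟶ S t ⊗ S s) {s t r : I}
    (e : S s ⊗ (S t ⊗ S r) ⟶ (S t ⊗ S r) ⊗ S s)
    (he : ∀ p, e ≫ (V.v t r p ▷ S s) = (S s ◁ V.v t r p) ≫ c s p) :
    (α_ (S s) (S t) (S r)).hom ≫ e ≫ (α_ (S t) (S r) (S s)).hom =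
      (c s t ▷ S r) ≫ (α_ (S t) (S s) (S r)).hom ≫ (S t ◁ c s r) ↔
    ∀ u p' q, ∑ p, V.assocSymbol h s t r u p' p * V.braidSymbol h (c s p) u *
      V.assocSymbol h t r s u p q =
      V.braidSymbol h (c s t) p' * V.assocSymbol h t s r u p' q * V.braidSymbol h (c s r) q := by
  have hl : ∀ q u, ((α_ (S s) (S t) (S r)).hom ≫ e ≫ (α_ (S t) (S r) (S s)).hom) ≫
      (S t ◁ V.v r s q) ≫ V.v t q u =
      ∑ p', (∑ p, V.assocSymbol h s t r u p' p * V.braidSymbol h (c s p) u *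
        V.assocSymbol h t r s u p q) • ((V.v s t p' ▷ S r) ≫ V.v p' r u) := by
    intro q u
    rw [Category.assoc, Category.assoc, V.assoc_comp h]
    simp only [Preadditive.comp_sum, Linear.comp_smul]
    have : ∀ p, (α_ (S s) (S t) (S r)).hom ≫ e ≫ V.v t r p ▷ S s ≫ V.v p s u =
        ∑ p', (V.assocSymbol h s t r u p' p * V.braidSymbol h (c s p) u) •
          ((V.v s t p' ▷ S r) ≫ V.v p' r u) := by
      intro p
      rw [← Category.assoc e, he, Category.assoc, V.comp_v h, Linear.comp_smul, Linear.comp_smul,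
        V.assoc_comp h, Finset.smul_sum]
      simp only [smul_smul, mul_comm]
    simp only [this, Finset.smul_sum, Finset.sum_smul, smul_smul]
    rw [Finset.sum_comm]
    simp only [mul_comm]
  have hr : ∀ q u, ((c s t ▷ S r) ≫ (α_ (S t) (S s) (S r)).hom ≫ (S t ◁ c s r)) ≫
      (S t ◁ V.v r s q) ≫ V.v t q u =
      ∑ p', (V.braidSymbol h (c s t) p' * V.assocSymbol h t s r u p' q *
        V.braidSymbol h (c s r) q) • ((V.v s t p' ▷ S r) ≫ V.v p' r u) := by
    intro q u
    rw [Category.assoc, Category.assoc, ← MonoidalCategory.whiskerLeft_comp_assoc, V.comp_v h,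
      MonoidalLinear.whiskerLeft_smul, Linear.smul_comp, Linear.comp_smul, Linear.comp_smul,
      V.assoc_comp h]
    simp only [Preadditive.comp_sum, Linear.comp_smul, Finset.smul_sum]
    refine Finset.sum_congr rfl fun p' _ => ?_
    rw [← comp_whiskerRight_assoc, V.comp_v h, MonoidalLinear.smul_whiskerRight, Linear.smul_comp,
      smul_smul, smul_smul]
    congr 1
    ring
  constructor
  · intro H u p' q
    by_cases hN : N s t p' ∧ N p' r u
    · exact V.path_ext h ((hl q u).symm.trans ((congrArg (· ≫ _) H).trans (hr q u))) p' hN.1 hN.2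
    · by_cases h1 : N s t p'
      · have h2 : ¬ N p' r u := fun h2 => hN ⟨h1, h2⟩
        rw [V.assocSymbol_eq_zero h (p := p') (r := r) (q := q) (fun h => h2 h.2.1),
          Finset.sum_eq_zero]
        · simp
        · intro p _
          rw [V.assocSymbol_eq_zero h fun h => h2 h.2.1]; simp
      · rw [braidSymbol, V.w_eq_zero s t p' h1, Finset.sum_eq_zero]
        · simp [h.scalar_zero]
        · intro p _
          rw [V.assocSymbol_eq_zero h fun h => h1 h.1]; simp
  · intro H
    refine V.hom_ext₃ fun q u => ?_
    rw [hl, hr]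
    simp only [H]

lemma hexagon_of_braided (V : FusionBasis S N) (h : IsSemisimple R S) (c : BraidedCategory C) :
    Hexagon (V.assocSymbol h) fun s t u => V.braidSymbol h (c.braiding (S s) (S t)).hom u := by
  intro s t r u p' q
  refine (V.hexagon_iff h (fun s t => (c.braiding (S s) (S t)).hom)
    (c.braiding (S s) (S t ⊗ S r)).hom fun p => ?_).1 (c.hexagon_forward _ _ _) u p' q
  exact (c.braiding_naturality_right _ _).symm

/-- The morphism `S s ⊗ S t ⟶ S t ⊗ S s` with the braiding symbols `b`. -/
def ofSymbol (V : FusionBasis S N) (b : I → I → I → R) (s t : I) : S s ⊗ S t ⟶ S t ⊗ S s :=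
  ∑ u, b s t u • (V.v s t u ≫ V.w t s u)

lemma ofSymbol_comp_v (V : FusionBasis S N) (h : IsSemisimple R S)
    (hN : ∀ s t u, N s t u → N t s u) (b : I → I → I → R) (s t u : I) :
    V.ofSymbol b s t ≫ V.v t s u = b s t u • V.v s t u := by
  rw [ofSymbol, Preadditive.sum_comp, Fintype.sum_eq_single u]
  · by_cases hu : N s t u
    · rw [Linear.smul_comp, Category.assoc, V.w_v _ _ _ (hN _ _ _ hu), Category.comp_id]
    · simp [V.v_eq_zero _ _ _ hu]
  · intro u' hu'
    rw [Linear.smul_comp, Category.assoc, h.hom_eq_zero _ _ hu' (V.w t s u' ≫ _)]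
    simp

lemma ofSymbol_comp_ofSymbol (V : FusionBasis S N) (h : IsSemisimple R S)
    (hN : ∀ s t u, N s t u → N t s u) {b b' : I → I → I → R}
    (hb : ∀ s t u, N s t u → b s t u * b' t s u = 1) (s t : I) :
    V.ofSymbol b s t ≫ V.ofSymbol b' t s = 𝟙 _ := by
  refine V.hom_ext fun u => ?_
  rw [Category.assoc, V.ofSymbol_comp_v h hN, Linear.comp_smul, V.ofSymbol_comp_v h hN, smul_smul,
    Category.id_comp]
  by_cases hu : N s t u
  · rw [mul_comm, hb _ _ _ hu, one_smul]
  · rw [V.v_eq_zero _ _ _ hu, smul_zero]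

lemma extend_ofSymbol_hexagon (V : FusionBasis S N) (h : IsSemisimple R S)
    (hN : ∀ s t u, N s t u → N t s u) {b : I → I → I → R}
    (H : Hexagon (V.assocSymbol h) b) (X Y Z : C) :
    (α_ X Y Z).hom ≫ h.extend (V.ofSymbol b) X (Y ⊗ Z) ≫ (α_ Y Z X).hom =
      (h.extend (V.ofSymbol b) X Y ▷ Z) ≫ (α_ Y X Z).hom ≫
        (Y ◁ h.extend (V.ofSymbol b) X Z) := by
  refine h.extend_hexagon (fun s t r => ?_) X Y Z
  refine (V.hexagon_iff h (V.ofSymbol b) _ fun p => ?_).2 fun u p' q => ?_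
  · have := h.extend_naturality (V.ofSymbol b) (𝟙 (S s)) (V.v t r p)
    rw [h.extend_self] at this
    simpa using this.symm
  · -- `b` is unconstrained on inadmissible triples, where the symbols of `ofSymbol b` vanish; there
    -- the associativity symbols vanish as well
    have hb : ∀ s t u, N s t u → V.braidSymbol h (V.ofSymbol b s t) u = b s t u := by
      intro s t u hu
      rw [braidSymbol, V.ofSymbol_comp_v h hN, Linear.comp_smul, V.w_v _ _ _ hu, h.scalar_smul_id]
    have := H s t r u p' q
    rw [Finset.sum_congr rfl fun p _ => ?_, this]
    · by_cases hF : N t s p' ∧ N p' r u ∧ N s r q ∧ N t q u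
      · rw [hb _ _ _ (hN _ _ _ hF.1), hb _ _ _ hF.2.2.1]
      · rw [V.assocSymbol_eq_zero h hF]; simp
    · by_cases hF : N s t p' ∧ N p' r u ∧ N t r p ∧ N s p u
      · rw [hb _ _ _ hF.2.2.2]
      · rw [V.assocSymbol_eq_zero h hF]; simp

/-- The natural isomorphism `X ⊗ Y ≅ Y ⊗ X` with symbols `b`, and `b'` for the inverse. -/
noncomputable def braidIso (V : FusionBasis S N) (h : IsSemisimple R S)
    (hN : ∀ s t u, N s t u → N t s u) {b b' : I → I → I → R}
    (hb : ∀ s t u, N s t u → b s t u * b' t s u = 1) (X Y : C) : X ⊗ Y ≅ Y ⊗ X where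
  hom := h.extend (V.ofSymbol b) X Y
  inv := h.extend (V.ofSymbol b') Y X
  hom_inv_id := h.extend_comp_extend (V.ofSymbol_comp_ofSymbol h hN hb) X Y
  inv_hom_id := h.extend_comp_extend (V.ofSymbol_comp_ofSymbol h hN fun s t u hu => by
    rw [mul_comm, hb _ _ _ (hN _ _ _ hu)]) Y X

/-- The braiding with symbols `b`. The reverse hexagon is the forward hexagon of the inverse
braiding, whose symbols are `b'`. -/
@[reducible] noncomputable def braided (V : FusionBasis S N) (h : IsSemisimple R S)
    (hN : ∀ s t u, N s t u → N t s u) {b b' : I → I → I → R}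
    (hb : ∀ s t u, N s t u → b s t u * b' t s u = 1) (H : Hexagon (V.assocSymbol h) b)
    (H' : Hexagon (V.assocSymbol h) b') : BraidedCategory C where
  braiding X Y := V.braidIso h hN hb X Y
  braiding_naturality_right X Y Z f := by
    simpa [braidIso] using h.extend_naturality (V.ofSymbol b) (𝟙 X) f
  braiding_naturality_left f Z := by
    simpa [braidIso] using h.extend_naturality (V.ofSymbol b) f (𝟙 Z)
  hexagon_forward X Y Z := V.extend_ofSymbol_hexagon h hN H X Y Z
  hexagon_reverse X Y Z := by
    have e : α_ Z X Y ≪≫ (V.braidIso h hN hb (X ⊗ Y) Z).symm ≪≫ α_ X Y Z =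
        whiskerRightIso (V.braidIso h hN hb X Z).symm Y ≪≫ α_ X Z Y ≪≫
          whiskerLeftIso X (V.braidIso h hN hb Y Z).symm :=
      Iso.ext (V.extend_ofSymbol_hexagon h hN H' Z X Y)
    simpa using congrArg Iso.inv e

lemma braided_comp_v (V : FusionBasis S N) (h : IsSemisimple R S)
    (hN : ∀ s t u, N s t u → N t s u) {b b' : I → I → I → R}
    (hb : ∀ s t u, N s t u → b s t u * b' t s u = 1) (H : Hexagon (V.assocSymbol h) b)
    (H' : Hexagon (V.assocSymbol h) b') (s t u : I) :
    ((V.braided h hN hb H H').braiding (S s) (S t)).hom ≫ V.v t s u = b s t u • V.v s t u := by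
  change h.extend (V.ofSymbol b) (S s) (S t) ≫ _ = _
  rw [h.extend_self, V.ofSymbol_comp_v h hN]

/-- The symbols determine the braiding. -/
lemma braided_ext (V : FusionBasis S N) (h : IsSemisimple R S) {c c' : BraidedCategory C}
    (e : ∀ s t u, N s t u → V.braidSymbol h (c.braiding (S s) (S t)).hom u =
      V.braidSymbol h (c'.braiding (S s) (S t)).hom u) : c = c' := by
  have key : ∀ X Y, (c.braiding X Y).hom = (c'.braiding X Y).hom := by
    intro X Y
    refine h.hom_ext_tensor fun t s y x => ?_
    rw [← @BraidedCategory.braiding_naturality _ _ _ c,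
      ← @BraidedCategory.braiding_naturality _ _ _ c']
    congr 1
    refine V.hom_ext fun u => ?_
    rw [V.comp_v h, V.comp_v h]
    by_cases hu : N s t u
    · rw [e _ _ _ hu]
    · rw [V.v_eq_zero _ _ _ hu, smul_zero, smul_zero]
  obtain ⟨b, _, _, _, _⟩ := c
  obtain ⟨b', _, _, _, _⟩ := c'
  have : b = b' := by
    funext X Y
    exact Iso.ext (key X Y)
  subst this
  rfl

/-- The inverse of a braiding is a braiding, so its symbols satisfy the hexagon identity. -/
lemma hexagon_of_braided_symm (V : FusionBasis S N) (h : IsSemisimple R S)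
    (c : BraidedCategory C) :
    Hexagon (V.assocSymbol h) fun s t u => V.braidSymbol h (c.braiding (S t) (S s)).inv u :=
  V.hexagon_of_braided h (@reverseBraiding C _ _ c)

lemma braidSymbol_mul_symm (V : FusionBasis S N) (h : IsSemisimple R S) (c : BraidedCategory C)
    {s t u : I} (hN : N s t u) : V.braidSymbol h (c.braiding (S s) (S t)).hom u *
      V.braidSymbol h (c.braiding (S s) (S t)).inv u = 1 := by
  refine V.smul_v_injective h hN ?_
  rw [mul_comm, mul_smul, ← V.comp_v h, ← Linear.comp_smul, ← V.comp_v h, Iso.hom_inv_id_assoc,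
    one_smul]

end FusionBasis

end FusionBasis

/-! ### The associativity symbols of a near-group category -/

section NormalForm

variable {R : Type w} [CommRing R] {G : Type t} [CommGroup G] [Fintype G]

/-- The fusion rules of a near-group category: `Fusion s t u` if `u` occurs in `s ⊗ t`. The simple
objects are indexed by `Option G`, where `none` stands for `m`. -/
def Fusion : Option G → Option G → Option G → Prop
  | some a, some b, some c => a * b = c
  | some _, none, none => True
  | none, some _, none => True
  | none, none, some _ => True
  | _, _, _ => False

@[simp] lemma fusion_some {a b c : G} : Fusion (some a) (some b) (some c) ↔ a * b = c := Iff.rfl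
@[simp] lemma fusion_left {a : G} : Fusion (some a) none none := trivial
@[simp] lemma fusion_right {a : G} : Fusion none (some a) none := trivial
@[simp] lemma fusion_none {a : G} : Fusion none none (some a) := trivial
@[simp] lemma not_fusion₁ {a b : G} : ¬ Fusion (some a) (some b) none := id
@[simp] lemma not_fusion₂ {a b : G} : ¬ Fusion (some a) none (some b) := id
@[simp] lemma not_fusion₃ {a b : G} : ¬ Fusion none (some a) (some b) := id
@[simp] lemma not_fusion₄ : ¬ Fusion (none : Option G) none none := id

lemma Fusion.symm {s t u : Option G} (h : Fusion s t u) : Fusion t s u := by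
  rcases s with _ | a <;> rcases t with _ | b <;> rcases u with _ | c <;> simp_all [mul_comm]

/-- The properties of the symbols of an associator that do not involve the category: the fusion
rules, the pentagon, and the invertibility of the blocks of size one. -/
structure IsAssocSymbol (f : Option G → Option G → Option G → Option G → Option G → Option G → R) :
    Prop where
  eq_zero : ∀ {s t r u p q}, ¬ (Fusion s t p ∧ Fusion p r u ∧ Fusion t r q ∧ Fusion s q u) →
    f s t r u p q = 0
  pentagon : ∀ s t r z u a b p x, Fusion s t p → Fusion p r x → Fusion x z u →
    f s t a u p b * f p r z u x a = ∑ c, f t r z b c a * f s c z u x b * f s t r x p c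
  isUnit : ∀ {s t r u p q}, Fusion s t p → Fusion p r u →
    (∀ p', Fusion s t p' → Fusion p' r u → p' = p) →
    (∀ q', Fusion t r q' → Fusion s q' u → q' = q) → IsUnit (f s t r u p q)

/-- A nondegenerate symmetric bicharacter `χ` of `G` with a square root `τ` of `|G|⁻¹`.
Nondegeneracy is expressed by the vanishing of character sums, which is what the pentagon yields and
what the Gauss sum computations use. -/
structure IsDatum (χ : G → G → R) (τ : R) : Prop where
  mul_left : ∀ a b c, χ (a * b) c = χ a c * χ b c
  symm : ∀ a b, χ a b = χ b a
  one_left : ∀ a, χ 1 a = 1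
  tau_sq : τ ^ 2 * Fintype.card G = 1
  sum_eq_zero : ∀ k, k ≠ 1 → ∑ c, χ c k = 0

open scoped Classical in
/-- The Tambara–Yamagami normal form of the associativity symbols: they are `χ` on `a m b` and
`m a m`, `τ χ⁻¹` on `m m m`, and trivial otherwise. -/
noncomputable def normalForm (χ : G → G → R) (τ : R) :
    Option G → Option G → Option G → Option G → Option G → Option G → R
  | some a, some b, some c, some u, some p, some q =>
      if p = a * b ∧ q = b * c ∧ u = a * b * c then 1 else 0
  | some a, some b, none, none, some p, none => if p = a * b then 1 else 0
  | none, some a, some b, none, none, some q => if q = a * b then 1 else 0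
  | some a, none, some b, none, none, none => χ a b
  | some a, none, none, some u, none, some q => if u = a * q then 1 else 0
  | none, none, some a, some u, some p, none => if u = p * a then 1 else 0
  | none, some a, none, some u, none, none => χ u a
  | none, none, none, none, some p, some q => τ * χ p q⁻¹
  | _, _, _, _, _, _ => 0

/-- The normalizations of the basis that determine it up to the scalings of `Hom(a m, m)` and
`Hom(m m, 1)`. -/
structure IsNormalized
    (f : Option G → Option G → Option G → Option G → Option G → Option G → R) : Prop where
  left : ∀ a b, f (some a) (some b) none none (some (a * b)) none = 1
  middle : ∀ a, f none (some a) none (some 1) none none = 1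
  right : ∀ a, f (some a) none none (some a) none (some 1) = 1

namespace IsAssocSymbol

variable {f : Option G → Option G → Option G → Option G → Option G → Option G → R}

/-- The pentagon when a single intermediate object `c` is admissible. -/
lemma pentagon_single (hf : IsAssocSymbol f) (s t r z u a b p x c : Option G)
    (h1 : Fusion s t p) (h2 : Fusion p r x) (h3 : Fusion x z u)
    (hc : ∀ c', Fusion t r c' → Fusion c' z b → Fusion s c' x → c' = c) :
    f s t a u p b * f p r z u x a = f t r z b c a * f s c z u x b * f s t r x p c := by
  rw [hf.pentagon s t r z u a b p x h1 h2 h3, Fintype.sum_eq_single c]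
  intro c' hc'
  by_cases h4 : Fusion t r c'
  · by_cases h5 : Fusion c' z b
    · have h6 : ¬ Fusion s c' x := fun h6 => hc' (hc _ h4 h5 h6)
      rw [hf.eq_zero (s := s) (t := t) (r := r) fun h => h6 h.2.2.2, mul_zero]
    · rw [hf.eq_zero (s := t) (t := r) (r := z) fun h => h5 h.2.1, zero_mul, zero_mul]
  · rw [hf.eq_zero (s := t) (t := r) (r := z) fun h => h4 h.1, zero_mul, zero_mul]

/-- The pentagon for `a b c m`: the normalization of `a b m` trivializes the associator on `G`. -/
lemma group_eq_one (hf : IsAssocSymbol f)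
    (hB : ∀ a b, f (some a) (some b) none none (some (a * b)) none = 1) {a b c p q u : G}
    (hp : a * b = p) (hq : b * c = q) (hu : p * c = u) :
    f (some a) (some b) (some c) (some u) (some p) (some q) = 1 := by
  subst hp hq hu
  have := hf.pentagon_single (some a) (some b) (some c) none none none none (some (a * b))
    (some (a * b * c)) (some (b * c)) (by simp) (by simp) (by simp)
    (by rintro (_ | c') <;> simp +contextual [eq_comm])
  have h2 := hB a (b * c)
  rw [← mul_assoc] at h2
  rw [hB, hB, hB, h2] at this
  simpa using this.symm

/-- Normalized associativity symbols are in Tambara–Yamagami normal form. Each step evaluates the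
pentagon for one quadruple of simple objects. -/
theorem exists_eq_normalForm [IsDomain R] (hf : IsAssocSymbol f) (hn : IsNormalized f) :
    ∃ χ τ, IsDatum χ τ ∧ f = normalForm χ τ := by
  have hB : ∀ a b p, a * b = p → f (some a) (some b) none none (some p) none = 1 := by
    rintro a b _ rfl; exact hn.left a b
  have hA := fun a b c p q u =>
    hf.group_eq_one hn.left (a := a) (b := b) (c := c) (p := p) (q := q) (u := u)
  -- the pentagon for `a b m m`
  have hE : ∀ a q u, a * q = u → f (some a) none none (some u) none (some q) = 1 := by
    rintro a b _ rfl
    have := hf.pentagon_single (some a) (some b) none none (some (a * b)) (some 1) (some b)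
      (some (a * b)) none none (by simp) (by simp) (by simp) (by rintro (_ | c') <;> simp)
    rw [hA _ _ _ _ _ _ rfl (by simp) (by simp), hn.right, hn.right, hB _ _ _ rfl] at this
    simpa using this.symm
  -- the pentagon for `m a b m`
  have hD : ∀ a b q, a * b = q → f none (some a) (some b) none none (some q) = 1 := by
    rintro a b _ rfl
    have := hf.pentagon_single none (some a) (some b) none (some 1) none none none none
      (some (a * b)) (by simp) (by simp) (by simp)
      (by rintro (_ | c') <;> simp +contextual [eq_comm])
    rw [hn.middle, hn.middle, hn.middle, hB _ _ _ rfl] at this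
    simpa using this.symm
  obtain ⟨χ, hχ⟩ : ∃ χ : G → G → R, ∀ a b, f (some a) none (some b) none none none = χ a b :=
    ⟨_, fun _ _ => rfl⟩
  -- the pentagon for `a b m c`
  have hmul : ∀ a b c, χ (a * b) c = χ a c * χ b c := by
    intro a b c
    have := hf.pentagon_single (some a) (some b) none (some c) none none none (some (a * b)) none
      none (by simp) (by simp) (by simp) (by rintro (_ | c') <;> simp)
    rw [hB _ _ _ rfl, hχ, hχ, hχ, one_mul, mul_one] at this
    rw [this, mul_comm]
  -- the pentagon for `a m b m`
  have hKχ : ∀ a b, f none (some b) none (some a) none none = χ a b := by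
    intro a b
    have := hf.pentagon_single (some a) none (some b) none (some a) none (some 1) none none none
      (by simp) (by simp) (by simp) (by rintro (_ | c') <;> simp)
    rw [hE _ _ _ (mul_one a), hn.middle, hχ, one_mul, one_mul, one_mul] at this
    exact this
  have hLunit : ∀ a p u, p * a = u → IsUnit (f none none (some a) (some u) (some p) none) := by
    rintro a p _ rfl
    refine hf.isUnit (by simp) (by simp) ?_ ?_ <;> rintro (_ | c') <;> simp
  -- the pentagon for `m a m b`
  have hsymm : ∀ a b, χ a b = χ b a := by
    intro a b
    have := hf.pentagon_single none (some a) none (some b) (some b) none none none (some 1) none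
      (by simp) (by simp) (by simp) (by rintro (_ | c') <;> simp)
    rw [hKχ, hn.middle, hχ, mul_one] at this
    exact ((hLunit b 1 b (one_mul b)).mul_right_cancel this).symm
  have hone : ∀ a, χ 1 a = 1 := by
    intro a
    have hu : IsUnit (χ 1 a) := by
      rw [← hχ]
      refine hf.isUnit (by simp) (by simp) ?_ ?_ <;> rintro (_ | c') <;> simp
    have := hmul 1 1 a
    rw [mul_one] at this
    exact (hu.mul_left_cancel (by rw [mul_one]; exact this)).symm
  -- the pentagon for `x m m b`
  have hL : ∀ b x, f none none (some b) (some (x * b)) (some x) none =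
      f none none (some b) (some b) (some 1) none := by
    intro b x
    have := hf.pentagon_single (some x) none none (some b) (some (x * b)) none (some b) none
      (some x) (some 1) (by simp) (by simp) (by simp) (by rintro (_ | c') <;> simp)
    rw [hE _ _ _ rfl, hE _ _ _ (mul_one x), hA _ _ _ _ _ _ (mul_one x) (one_mul b) rfl] at this
    simpa using this
  -- the pentagon for `m a m m`
  have hM₁ : ∀ h g a, f none none none none (some h) (some g) =
      f none none none none (some h) (some (a * g)) * χ h a := by
    intro h g a
    have := hf.pentagon_single none (some a) none none none (some g) (some (a * g)) none (some h)
      none (by simp) (by simp) (by simp) (by rintro (_ | c') <;> simp)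
    rw [hD _ _ _ rfl, hE _ _ _ rfl, hKχ] at this
    simpa using this
  -- the pentagon for `a m m m`
  have hM₂ : ∀ a c g, χ a g * f none none none none (some (a * c)) (some g) =
      f none none none none (some c) (some g) := by
    intro a c g
    have := hf.pentagon_single (some a) none none none none (some g) none none (some (a * c))
      (some c) (by simp) (by simp) (by simp) (by rintro (_ | c') <;> simp)
    rw [hχ, hB _ _ _ rfl, hE _ _ _ rfl] at this
    simpa using this
  have hinv : ∀ a b, χ a b⁻¹ * χ a b = 1 := by
    intro a b
    rw [hsymm a, hsymm a, ← hmul, inv_mul_cancel, hone]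
  obtain ⟨τ, hτ⟩ : ∃ τ, f none none none none (some 1) (some 1) = τ := ⟨_, rfl⟩
  have hM : ∀ h g, f none none none none (some h) (some g) = τ * χ h g⁻¹ := by
    intro h g
    have e1 := hM₁ h 1 g
    have e2 := hM₂ h 1 1
    rw [mul_one] at e1 e2
    rw [hsymm, hone, one_mul, hτ] at e2
    rw [← e2, e1, mul_assoc, mul_comm (χ h g), hinv, mul_one]
  -- the pentagon for `m m m m`, the only one with a sum: it gives the character sums of `χ`
  have hsum : ∀ p g u, f none none (some g) (some u) (some p) none *
      f (some p) none none (some u) none (some g) = τ ^ 2 * ∑ c, χ c (g⁻¹ * u * p⁻¹) := by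
    intro p g u
    rw [hf.pentagon none none none none (some u) (some g) none (some p) none (by simp) (by simp)
      (by simp), Fintype.sum_option, hf.eq_zero (s := none) (t := none) (r := none) (by simp),
      zero_mul, zero_mul, zero_add, Finset.mul_sum]
    refine Finset.sum_congr rfl fun c _ => ?_
    have e : χ p c⁻¹ = χ c p⁻¹ := by
      have e1 := hinv p c
      have e2 := hinv c p
      rw [hsymm c p] at e2
      exact (IsUnit.of_mul_eq_one_right _ e1).mul_right_cancel (e1.trans e2.symm)
    rw [hM, hM, hKχ, e, hsymm c (_ * _), hmul, hmul, hsymm c g⁻¹, hsymm c p⁻¹]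
    ring
  have hcard : ∀ g, f none none (some g) (some g) (some 1) none =
      τ ^ 2 * Fintype.card G := by
    intro g
    have := hsum 1 g g
    rw [hE _ _ _ (one_mul g), mul_one] at this
    rw [this]
    simp [hsymm _ (1 : G), hone]
  have hτ0 : τ ≠ 0 := by
    rintro rfl
    have h1 := hLunit 1 1 1 (one_mul 1)
    rw [hcard] at h1
    simp at h1
  -- the pentagon for `m m m b`, in which the nonzero scalar `τ` cancels
  have hL1 : ∀ b p u, p * b = u → f none none (some b) (some u) (some p) none = 1 := by
    rintro b p _ rfl
    have := hf.pentagon_single none none none (some b) none none (some b) (some 1) none (some 1)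
      (by simp) (by simp) (by simp) (by rintro (_ | c') <;> simp)
    rw [hχ, hD _ _ _ (one_mul b), hM, hM, hone, hone, hone] at this
    rw [hL]
    simp only [mul_one] at this
    exact mul_right_cancel₀ hτ0 (by rw [← this, one_mul])
  refine ⟨χ, τ, ⟨hmul, hsymm, hone, ?_, ?_⟩, ?_⟩
  · rw [← hcard 1, hL1 _ _ _ (one_mul 1)]
  · intro k hk
    have := hsum 1 1 k
    rw [hf.eq_zero (s := none) (t := none) (r := some 1) (by simpa using hk.symm), zero_mul] at this
    simpa [hτ0] using this.symm
  · funext s t r u p q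
    by_cases hN : Fusion s t p ∧ Fusion p r u ∧ Fusion t r q ∧ Fusion s q u
    · rcases s with _ | a <;> rcases t with _ | b <;> rcases r with _ | c <;>
        rcases u with _ | u <;> rcases p with _ | p <;> rcases q with _ | q <;>
        simp only [fusion_some, fusion_left, fusion_right, fusion_none, not_fusion₁, not_fusion₂,
          not_fusion₃, not_fusion₄, true_and, and_true, false_and, and_false] at hN
      all_goals simp only [normalForm]
      · exact hM _ _
      · rw [hL1 _ _ _ hN, if_pos hN.symm]
      · exact hKχ _ _
      · rw [hD _ _ _ hN, if_pos hN.symm]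
      · rw [hE _ _ _ hN, if_pos hN.symm]
      · exact hχ _ _
      · rw [hB _ _ _ hN, if_pos hN.symm]
      · rw [hA _ _ _ _ _ _ hN.1 hN.2.2.1 hN.2.1, if_pos]
        rw [hN.1, hN.2.1, hN.2.2.1]
        simp
    · rw [hf.eq_zero hN]
      rcases s with _ | a <;> rcases t with _ | b <;> rcases r with _ | c <;>
        rcases u with _ | u <;> rcases p with _ | p <;> rcases q with _ | q <;>
        simp only [normalForm]
      all_goals first
        | exact (if_neg fun h => hN (by simp [h, mul_assoc])).symm
        | exact (hN (by simp)).elim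

end IsAssocSymbol

section Normalization

variable {C : Type u} [Category.{v} C] [Preadditive C] [Linear R C]
  [HasFiniteBiproducts C] [MonoidalCategory C] [MonoidalPreadditive C] [MonoidalLinear R C]
  {S : Option G → C}

namespace FusionBasis

lemma isAssocSymbol (V : FusionBasis S Fusion) (h : IsSemisimple R S) :
    IsAssocSymbol (V.assocSymbol h) where
  eq_zero := V.assocSymbol_eq_zero h
  pentagon := V.assocSymbol_pentagon h
  isUnit := V.isUnit_assocSymbol h

/-- A fusion basis can be rescaled so that its associativity symbols are normalized: `Hom(a b, ab)`
absorbs the symbols of `a b m`, `Hom(m a, m)` those of `m a m`, and `Hom(m m, a)` those of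
`a m m`. -/
lemma exists_isNormalized (V : FusionBasis S Fusion) (h : IsSemisimple R S) :
    ∃ V' : FusionBasis S Fusion, IsNormalized (V'.assocSymbol h) := by
  have hf := V.isAssocSymbol h
  have hB : ∀ a b, IsUnit (V.assocSymbol h (some a) (some b) none none (some (a * b)) none) := by
    intro a b
    refine hf.isUnit (by simp) (by simp) ?_ ?_ <;> rintro (_ | c') <;> simp [eq_comm]
  have hK : ∀ a, IsUnit (V.assocSymbol h none (some a) none (some 1) none none) := by
    intro a
    refine hf.isUnit (by simp) (by simp) ?_ ?_ <;> rintro (_ | c') <;> simp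
  have hE : ∀ a, IsUnit (V.assocSymbol h (some a) none none (some a) none (some 1)) := by
    intro a
    refine hf.isUnit (by simp) (by simp) ?_ ?_ <;> rintro (_ | c') <;> simp
  choose B hB using hB
  choose K hK using hK
  choose E hE using hE
  let l : Option G → Option G → Option G → Rˣ
    | some a, some b, _ => B a b
    | none, some a, none => K a
    | none, none, some a => B a 1 * E a
    | _, _, _ => 1
  have hleft : ∀ a b,
      (V.rescale l).assocSymbol h (some a) (some b) none none (some (a * b)) none = 1 := by
    intro a b
    rw [V.assocSymbol_rescale h, ← hB]
    simp [l]
  refine ⟨V.rescale l, hleft, fun a => ?_, fun a => ?_⟩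
  · rw [V.assocSymbol_rescale h, ← hK, ← Units.val_mul, Units.val_eq_one]
    simp only [l, one_mul]
    rw [mul_right_comm (B 1 1 * E 1), mul_inv_cancel, one_mul, inv_mul_cancel]
  · have hε : ∀ a, (V.rescale l).assocSymbol h (some a) none none (some a) none (some 1) =
        ((B 1 1 * E 1 : Rˣ) : R) := by
      intro a
      rw [V.assocSymbol_rescale h, ← hE, ← Units.val_mul]
      congr 1
      simp only [l, inv_one, mul_one, mul_inv]
      group
    -- the leftover scalar is the value at `a = 1`, where the pentagon makes it idempotent
    have := ((V.rescale l).isAssocSymbol h).pentagon_single (some 1) (some 1) none none (some 1)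
      (some 1) (some 1) (some 1) none none (by simp) (by simp) (by simp)
      (by rintro (_ | c') <;> simp)
    have h1 := hleft 1 1
    rw [mul_one] at h1
    rw [((V.rescale l).isAssocSymbol h).group_eq_one hleft (by simp) (by simp) (by simp), hε,
      h1, one_mul, mul_one] at this
    rw [hε]
    exact ((B 1 1 * E 1).isUnit.mul_left_cancel (by rw [mul_one]; exact this)).symm

end FusionBasis

end Normalization

end NormalForm

/-! ### The hexagon identities in normal form -/

section Hexagon

variable {R : Type w} [CommRing R] {G : Type t} [CommGroup G] [Fintype G]

/-- A quadratic refinement of `χ`: a function with `σ(a b) = σ(a) σ(b) χ(a, b)` and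
`σ(a)² = χ(a, a)`. For elementary abelian 2-groups the second condition follows from the first and
`σ(1) = 1`. -/
structure IsQuadratic (χ : G → G → R) (σ : G → R) : Prop where
  sq : ∀ a, σ a * σ a = χ a a
  mul : ∀ a b, σ (a * b) = σ a * σ b * χ a b

/-- The braiding symbols `σ₀ = χ`, `σ₁ = σ₂ = σ` and `σ₃(a) = s σ(a)⁻¹`, where `σ(a)⁻¹` is written
`σ(a) χ(a, a)`. -/
def braidForm (χ : G → G → R) (σ : G → R) (s : R) : Option G → Option G → Option G → R
  | some a, some b, some _ => χ a b
  | some a, none, none => σ a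
  | none, some a, none => σ a
  | none, none, some a => s * (σ a * χ a a)
  | _, _, _ => 0

/-- The conditions under which `σ₁ = σ` and `σ₃(1) = s` define a braiding. -/
structure IsBraidData (χ : G → G → R) (τ : R) (σ : G → R) (s : R) : Prop
    extends IsQuadratic χ σ where
  chi_sq : ∀ a b, χ a b * χ a b = 1
  sq_eq_sum : s * s = τ * ∑ a, σ a

namespace IsDatum

variable {χ : G → G → R} {τ : R}

lemma mul_right (hχ : IsDatum χ τ) (a b c : G) : χ a (b * c) = χ a b * χ a c := by
  rw [hχ.symm, hχ.mul_left, hχ.symm b, hχ.symm c]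

lemma one_right (hχ : IsDatum χ τ) (a : G) : χ a 1 = 1 := by
  rw [hχ.symm, hχ.one_left]

lemma inv_right_mul (hχ : IsDatum χ τ) (a b : G) : χ a b⁻¹ * χ a b = 1 := by
  rw [← hχ.mul_right, inv_mul_cancel, hχ.one_right]

/-- The form `χ` is nondegenerate. -/
lemma eq_one_of_forall [Nontrivial R] (hχ : IsDatum χ τ) {k : G} (hk : ∀ c, χ c k = 1) :
    k = 1 := by
  by_contra h
  have h1 := hχ.sum_eq_zero k h
  simp only [hk, Finset.sum_const, Finset.card_univ, nsmul_eq_mul, mul_one] at h1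
  have h2 := hχ.tau_sq
  rw [h1, mul_zero] at h2
  exact zero_ne_one h2

lemma isElementaryTwo [Nontrivial R] (hχ : IsDatum χ τ) (h : ∀ a b, χ a b * χ a b = 1) :
    IsElementaryTwo G := fun g =>
  hχ.eq_one_of_forall fun c => by rw [sq, hχ.mul_right, h]

lemma chi_sq (hχ : IsDatum χ τ) (hG : IsElementaryTwo G) (a b : G) : χ a b * χ a b = 1 := by
  rw [← hχ.mul_left, ← sq, hG a, hχ.one_left]

/-- The symbols `b` of a braiding, with `b'` those of its inverse, are determined by `σ₁` and
`σ₃(1)`. Each step evaluates the hexagon for one triple of simple objects. -/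
theorem eq_braidForm_of_hexagon (hχ : IsDatum χ τ) {b b' : Option G → Option G → Option G → R}
    (H : Hexagon (normalForm χ τ) b) (H' : Hexagon (normalForm χ τ) b')
    (hb : ∀ s t u, Fusion s t u → b s t u * b' t s u = 1) :
    IsBraidData χ τ (fun a => b (some a) none none) (b none none (some 1)) ∧
    ∀ s t u, Fusion s t u →
      b s t u = braidForm χ (fun a => b (some a) none none) (b none none (some 1)) s t u := by
  obtain ⟨σ, hσ⟩ : ∃ σ : G → R, ∀ a, b (some a) none none = σ a := ⟨_, fun _ => rfl⟩
  obtain ⟨σ', hσ'⟩ : ∃ σ' : G → R, ∀ a, b' (some a) none none = σ' a := ⟨_, fun _ => rfl⟩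
  obtain ⟨ρ, hρ⟩ : ∃ ρ : G → R, ∀ a, b none (some a) none = ρ a := ⟨_, fun _ => rfl⟩
  obtain ⟨ρ', hρ'⟩ : ∃ ρ' : G → R, ∀ a, b' none (some a) none = ρ' a := ⟨_, fun _ => rfl⟩
  obtain ⟨φ, hφ⟩ : ∃ φ : G → R, ∀ a, b none none (some a) = φ a := ⟨_, fun _ => rfl⟩
  obtain ⟨φ', hφ'⟩ : ∃ φ' : G → R, ∀ a, b' none none (some a) = φ' a := ⟨_, fun _ => rfl⟩
  have iσ : ∀ a, σ a * ρ' a = 1 := fun a => by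
    have := hb (some a) none none (by simp); rwa [hσ, hρ'] at this
  have iρ : ∀ a, ρ a * σ' a = 1 := fun a => by
    have := hb none (some a) none (by simp); rwa [hρ, hσ'] at this
  have iφ : ∀ a, φ a * φ' a = 1 := fun a => by
    have := hb none none (some a) (by simp); rwa [hφ, hφ'] at this
  have uσ : ∀ a, IsUnit (σ a) := fun a => IsUnit.of_mul_eq_one _ (iσ a)
  have uσ' : ∀ a, IsUnit (σ' a) := fun a => IsUnit.of_mul_eq_one_right _ (iρ a)
  -- the hexagon for `a m k`: `σ₀ = χ`
  have h₀ : ∀ {c : Option G → Option G → Option G → R} (_ : Hexagon (normalForm χ τ) c)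
      (_ : ∀ a, IsUnit (c (some a) none none)) (a k : G),
      c (some a) (some k) (some (a * k)) = χ a k := by
    intro c Hc hc a k
    have := Hc (some a) none (some k) none none (some (a * k))
    simp only [normalForm, Fintype.sum_option, mul_comm k a, if_true, mul_one, mul_zero,
      Finset.sum_const_zero, add_zero] at this
    rw [mul_comm] at this
    exact ((hc a).mul_left_cancel this).symm
  -- the inverse braiding has `σ₀ = χ` too, whence `χ² = 1`
  have hχχ : ∀ a k, χ a k * χ a k = 1 := by
    intro a k
    have := hb (some a) (some k) (some (a * k)) (by simp)
    rw [h₀ H (by simpa only [hσ] using uσ), mul_comm a k,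
      h₀ H' (by simpa only [hσ'] using uσ'), hχ.symm k] at this
    exact this
  -- the hexagon for `a m m`
  have hsq : ∀ a, σ a * σ a = χ a a := by
    intro a
    have := H (some a) none none (some a) none none
    simp only [normalForm, Fintype.sum_option, zero_mul, zero_add, left_eq_mul, right_eq_mul, hσ]
      at this
    rw [Fintype.sum_eq_single 1 (by intro x hx; simp [hx])] at this
    have h1 := h₀ H (by simpa only [hσ] using uσ) a 1
    rw [mul_one, hχ.one_right] at h1
    simp only [if_true, one_mul, mul_one, h1] at this
    calc σ a * σ a = σ a * χ a a * σ a * χ a a := by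
          rw [mul_right_comm (σ a), mul_assoc, hχχ, mul_one]
      _ = χ a a := by rw [← this, one_mul]
  -- the hexagon for `m a c`, of the inverse braiding
  have hmul : ∀ a c, σ (a * c) = σ a * σ c * χ a c := by
    intro a c
    have := H' none (some a) (some c) none none none
    simp only [normalForm, Fintype.sum_option, zero_mul, zero_add, hρ'] at this
    rw [Fintype.sum_eq_single (a * c) (by intro x hx; simp [hx])] at this
    simp only [if_true, one_mul, mul_one] at this
    refine (IsUnit.of_mul_eq_one_right _ (iσ (a * c))).mul_right_cancel ((iσ _).trans ?_)
    rw [this]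
    linear_combination -χ a c * χ a c * iσ a - χ a c * χ a c * σ a * ρ' a * iσ c - hχχ a c
  -- the hexagon for `m a m`
  have hφ₁ : ∀ {c : Option G → Option G → Option G → R} (_ : Hexagon (normalForm χ τ) c) (a : G),
      χ a a * c none none (some a) = c none (some a) none * c none none (some 1) := by
    intro c Hc a
    have := Hc none (some a) none (some a) none (some 1)
    simpa [normalForm, Fintype.sum_option] using this
  have hφσ : ∀ a, φ a = φ 1 * (σ a * χ a a) := by
    intro a
    have := hφ₁ H' a
    rw [hφ', hφ', hρ'] at this
    linear_combination (-σ a * φ a * φ 1) * this + φ 1 * σ a * χ a a * iφ a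
      - φ a * σ a * ρ' a * iφ 1 - φ a * iσ a
  have hρσ : ∀ a, ρ a = σ a := by
    intro a
    have := hφ₁ H a
    rw [hφ, hφ, hρ, hφσ] at this
    refine (IsUnit.of_mul_eq_one _ (iφ 1)).mul_right_cancel ?_
    linear_combination -this + φ 1 * σ a * hχχ a a
  -- the hexagon for `m m m`
  have hS : φ 1 * φ 1 = τ * ∑ a, σ a := by
    have := H none none none none (some 1) (some 1)
    simp only [normalForm, Fintype.sum_option, inv_one, hχ.one_left, hχ.one_right, mul_one, hφ,
      hρ, hρσ, zero_mul, zero_add, ← Finset.sum_mul, ← Finset.mul_sum] at this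
    have hτ : IsUnit τ := IsUnit.of_mul_eq_one (τ * Fintype.card G) (by rw [← hχ.tau_sq]; ring)
    refine hτ.mul_left_cancel ?_
    linear_combination -this
  simp only [hσ, hφ]
  refine ⟨⟨⟨hsq, hmul⟩, hχχ, hS⟩, ?_⟩
  rintro (_ | a) (_ | c) (_ | d) hN <;> try exact False.elim hN
  · exact (hφ d).trans (hφσ d)
  · exact (hρ c).trans (hρσ c)
  · exact hσ a
  · rw [← fusion_some.1 hN]
    exact h₀ H (by simpa only [hσ] using uσ) a c

end IsDatum

namespace IsQuadratic

variable {χ : G → G → R} {τ : R} {σ : G → R}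

lemma one (h : IsQuadratic χ σ) (hχ : IsDatum χ τ) : σ 1 = 1 := by
  have h1 := h.mul 1 1
  rw [mul_one, h.sq 1, hχ.one_left, one_mul] at h1
  exact h1

/-- The Gauss sums of a quadratic refinement and of its inverse multiply to `|G|`. -/
lemma gauss_mul (h : IsQuadratic χ σ) (hχ : IsDatum χ τ)
    (h2 : ∀ a b, χ a b * χ a b = 1) :
    (∑ a, σ a) * ∑ a, σ a * χ a a = Fintype.card G := by
  have e : ∀ b a, σ (a * b) * (σ b * χ b b) = σ a * χ b a := by
    intro b a
    rw [h.mul, hχ.symm b a]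
    linear_combination (σ a * χ a b * χ b b) * h.sq b + σ a * χ a b * h2 b b
  have e1 : ∀ b, (∑ a, σ a) * (σ b * χ b b) = ∑ a, σ a * χ b a := by
    intro b
    rw [← Fintype.sum_equiv (Equiv.mulRight b) (fun a => σ (a * b)) σ fun _ => rfl,
      Finset.sum_mul]
    exact Finset.sum_congr rfl fun a _ => e b a
  rw [Finset.mul_sum, Finset.sum_congr rfl fun b _ => e1 b, Finset.sum_comm]
  simp only [← Finset.mul_sum]
  rw [Fintype.sum_eq_single 1]
  · simp [h.one hχ, hχ.one_right]
  · intro a ha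
    rw [hχ.sum_eq_zero a ha, mul_zero]

end IsQuadratic

namespace IsBraidData

variable {χ : G → G → R} {τ : R} {σ : G → R} {s : R}

lemma inv_arg (h : IsBraidData χ τ σ s) (hχ : IsDatum χ τ) (a b : G) : χ a b⁻¹ = χ a b := by
  have h1 := hχ.inv_right_mul a b
  have h2 := h.chi_sq a b
  exact (IsUnit.of_mul_eq_one _ h2).mul_right_cancel (h1.trans h2.symm)

/-- Conversely, such data satisfy the hexagon identity. The case `m m m` with total object `m` is a
translation of the Gauss sum. -/
theorem hexagon (h : IsBraidData χ τ σ s) (hχ : IsDatum χ τ) :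
    Hexagon (normalForm χ τ) (braidForm χ σ s) := by
  intro s t r u p q
  rcases s with _ | a <;> rcases t with _ | b <;> rcases r with _ | c <;>
    rcases u with _ | u <;> rcases p with _ | p <;> rcases q with _ | q <;>
    simp only [normalForm, braidForm, Fintype.sum_option, zero_mul, mul_zero,
      Finset.sum_const_zero, add_zero, zero_add]
  · have e : ∀ x, τ * χ p x⁻¹ * σ x * (τ * χ x q⁻¹) * σ (p * q) =
        τ * (τ * σ (x * (p * q))) := by
      intro x
      rw [h.inv_arg hχ, h.inv_arg hχ, h.mul x, hχ.mul_right x, hχ.symm p x]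
      ring
    have hS : ∑ x, σ (x * (p * q)) = ∑ x, σ x :=
      Fintype.sum_equiv (Equiv.mulRight (p * q)) _ _ fun _ => rfl
    refine (IsUnit.of_mul_eq_one (σ (p * q) * χ (p * q) (p * q)) ?_ :
      IsUnit (σ (p * q))).mul_right_cancel ?_
    · rw [← mul_assoc, h.sq, h.chi_sq]
    · rw [Finset.sum_mul, Finset.sum_congr rfl fun x _ => e x, ← Finset.mul_sum, ← Finset.mul_sum,
        hS, ← h.sq_eq_sum, h.mul, h.inv_arg hχ]
      have hp := h.sq p
      have hq := h.sq q
      linear_combination (-τ * s * s * χ p p * χ q q * χ p q * χ p q * σ q * σ q) * hp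
        - τ * s * s * χ p p * χ q q * χ p q * χ p q * χ p p * hq
        - τ * s * s * χ q q * χ q q * χ p q * χ p q * h.chi_sq p p
        - τ * s * s * χ p q * χ p q * h.chi_sq q q - τ * s * s * h.chi_sq p q
  · split_ifs with hu
    · simp only [hu, h.mul, hχ.mul_left, hχ.mul_right, hχ.symm c p]
      linear_combination (s * σ p * σ c * χ p p) * ((χ p c * χ p c * χ c c * χ c c) * h.chi_sq p c
        + (χ c c * χ c c) * h.chi_sq p c + h.chi_sq c c)
    · simp
  · split_ifs with hu
    · simp only [hu, h.mul, hχ.mul_left, hχ.mul_right, hχ.symm q b]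
      linear_combination (s * σ q * σ b * χ q q) * ((χ b q * χ b q * χ b b * χ b b) * h.chi_sq b q
        + (χ b b * χ b b) * h.chi_sq b q + h.chi_sq b b)
    · simp
  · rw [Fintype.sum_eq_single (b * c) (by intro x hx; simp [hx])]
    simp only [if_true, one_mul, mul_one, h.mul]
    ring
  · rw [Fintype.sum_eq_single (a⁻¹ * u)]
    · simp only [mul_inv_cancel_left, inv_mul_cancel_comm, if_true, one_mul, mul_one, hχ.mul_right]
      rw [hχ.symm u a, mul_right_comm, h.sq, h.inv_arg hχ]
    · intro x hx
      rw [if_neg fun e => hx (by rw [e, inv_mul_cancel_left]), zero_mul, zero_mul]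
  · rw [mul_comm c a]
    ring
  · rw [mul_comm b a, hχ.symm b a]
    ring
  · by_cases hN : p = a * b ∧ q = a * c ∧ u = a * b * c
    · obtain ⟨rfl, rfl, rfl⟩ := hN
      rw [Fintype.sum_eq_single (b * c) (by intro x hx; simp [hx])]
      rw [if_pos ⟨rfl, rfl, rfl⟩, if_pos ⟨rfl, mul_comm _ _, by ac_rfl⟩,
        if_pos ⟨mul_comm _ _, rfl, by ac_rfl⟩, hχ.mul_right]
      ring
    · rw [if_neg fun h => hN ⟨h.1.trans (mul_comm _ _), h.2.1, h.2.2.trans (by ac_rfl)⟩,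
        Finset.sum_eq_zero]
      · simp
      · intro x _
        by_cases h1 : p = a * b ∧ x = b * c ∧ u = a * b * c
        · have h2 : ¬ (x = b * c ∧ q = c * a ∧ u = b * c * a) := fun h =>
            hN ⟨h1.1, h.2.1.trans (mul_comm _ _), h1.2.2⟩
          rw [if_neg h2, mul_zero]
        · rw [if_neg h1, zero_mul, zero_mul]

/-- The data of the inverse braiding; the Gauss sum identity makes `s` a unit. -/
lemma exists_inverse (h : IsBraidData χ τ σ s) (hχ : IsDatum χ τ) :
    ∃ s', s * s' = 1 ∧ IsBraidData χ τ (fun a => σ a * χ a a) s' := by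
  have hST := h.gauss_mul hχ h.chi_sq
  have hτ := hχ.tau_sq
  have hS := h.sq_eq_sum
  refine ⟨s * τ * ∑ a, σ a * χ a a, ?_, ⟨fun a => ?_, fun a b => ?_⟩, h.chi_sq, ?_⟩
  · linear_combination (τ * ∑ a, σ a * χ a a) * hS + τ ^ 2 * hST + hτ
  · linear_combination χ a a * χ a a * h.sq a + χ a a * h.chi_sq a a
  · rw [h.mul, hχ.mul_left, hχ.mul_right, hχ.mul_right, hχ.symm b a]
    linear_combination (σ a * σ b * χ a b * χ a a * χ b b) * h.chi_sq a b
  · linear_combination (τ * ∑ a, σ a * χ a a) ^ 2 * hS +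
      τ * (∑ a, σ a * χ a a) * (τ ^ 2 * hST + hτ)

lemma braidForm_mul (h : IsBraidData χ τ σ s) (hχ : IsDatum χ τ) {s' : R}
    (hs : s * s' = 1) (x y z : Option G) (hN : Fusion x y z) :
    braidForm χ σ s x y z * braidForm χ (fun a => σ a * χ a a) s' y x z = 1 := by
  have e : ∀ a, σ a * (σ a * χ a a) = 1 := fun a => by rw [← mul_assoc, h.sq, h.chi_sq]
  rcases x with _ | a <;> rcases y with _ | b <;> rcases z with _ | c <;>
    first | exact False.elim hN | simp only [braidForm]
  · linear_combination (σ c * σ c * χ c c * χ c c * χ c c) * hs +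
      χ c c * χ c c * e c + h.chi_sq c c
  · exact e b
  · exact e a
  · rw [hχ.symm b a, h.chi_sq]

end IsBraidData

end Hexagon

/-! ### Quadratic functions on elementary abelian 2-groups -/

section Generators

/-- The product of the `g i` with `e i = true`. -/
def boolProd {M : Type*} [CommMonoid M] {n : ℕ} (g : Fin n → M) (e : Fin n → Bool) : M :=
  ∏ i, if e i then g i else 1

lemma boolProd_mul {M : Type*} [CommMonoid M] {n : ℕ} {g : Fin n → M} (hg : ∀ i, g i * g i = 1)
    (e f : Fin n → Bool) :
    boolProd g e * boolProd g f = boolProd g fun i => xor (e i) (f i) := by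
  rw [boolProd, boolProd, boolProd, ← Finset.prod_mul_distrib]
  refine Finset.prod_congr rfl fun i _ => ?_
  cases e i <;> cases f i <;> simp [hg]

lemma boolProd_single {M : Type*} [CommMonoid M] {n : ℕ} (g : Fin n → M) (i : Fin n) :
    boolProd g (fun j => decide (j = i)) = g i := by
  simp [boolProd]

variable {G : Type t} [CommGroup G] [Finite G]

/-- A generating family of minimal length of an elementary abelian 2-group is a basis. -/
lemma boolProd_bijective (hG : IsElementaryTwo G) (g : Fin (Group.rank G) → G)
    (hg : Subgroup.closure (Set.range g) = ⊤) : Function.Bijective (boolProd g) := by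
  have hsq : ∀ x : G, x * x = 1 := fun x => by rw [← sq, hG]
  have hinv : ∀ x : G, x⁻¹ = x := fun x => inv_eq_of_mul_eq_one_left (hsq x)
  constructor
  · intro e f hef
    by_contra hne
    obtain ⟨j, hj⟩ := Function.ne_iff.1 hne
    have h1 : boolProd g (fun i => xor (e i) (f i)) = 1 := by
      rw [← boolProd_mul (fun i => hsq _), hef, hsq]
    classical
    let T : Finset G := (Finset.univ.erase j).image g
    have hmem : ∀ i, i ≠ j → g i ∈ Subgroup.closure (T : Set G) := fun i hi =>
      Subgroup.subset_closure (by
        simp only [T, Finset.coe_image, Set.mem_image, Finset.mem_coe, Finset.mem_erase]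
        exact ⟨i, ⟨hi, Finset.mem_univ _⟩, rfl⟩)
    have hjmem : g j ∈ Subgroup.closure (T : Set G) := by
      rw [boolProd, ← Finset.mul_prod_erase _ _ (Finset.mem_univ j)] at h1
      have h2 : (e j ^^ f j) = true := by cases h3 : e j <;> cases h4 : f j <;> simp_all
      rw [if_pos h2] at h1
      rw [← hinv (g j), inv_eq_of_mul_eq_one_right h1]
      refine Subgroup.prod_mem _ fun i hi => ?_
      split_ifs
      · exact hmem i (Finset.ne_of_mem_erase hi)
      · exact one_mem _
    have htop : Subgroup.closure (T : Set G) = ⊤ := by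
      rw [eq_top_iff, ← hg, Subgroup.closure_le]
      rintro _ ⟨i, rfl⟩
      by_cases hi : i = j
      · rw [hi]; exact hjmem
      · exact hmem i hi
    have h3 := Group.rank_le htop
    have h4 : T.card ≤ Group.rank G - 1 := by
      refine Finset.card_image_le.trans ?_
      simp
    have h5 := j.pos
    omega
  · intro x
    have hx : x ∈ Subgroup.closure (Set.range g) := by rw [hg]; trivial
    induction hx using Subgroup.closure_induction with
    | mem x hx =>
      obtain ⟨i, rfl⟩ := hx
      exact ⟨_, boolProd_single g i⟩
    | one => exact ⟨fun _ => false, by simp [boolProd]⟩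
    | mul x y _ _ hx hy =>
      obtain ⟨e, rfl⟩ := hx
      obtain ⟨f, rfl⟩ := hy
      exact ⟨_, (boolProd_mul (fun i => hsq _) e f).symm⟩
    | inv x _ hx => rwa [hinv]

end Generators

section Quadratic

variable {R : Type w} [CommRing R] {G : Type t} [CommGroup G] [Fintype G]

variable {χ : G → G → R} {τ : R}

/-- The commutative monoid `R × G` with product `(x, a) (y, b) = (x y χ(a, b), a b)`. A function
`σ` with `σ(a b) = σ(a) σ(b) χ(a, b)` and `σ(1) = 1` is a multiplicative section over `G`, which may
be prescribed on a basis of `G` by elements of square one. -/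
@[ext] structure TwistedProd (hχ : IsDatum χ τ) where
  /-- the scalar component -/
  fst : R
  /-- the group component -/
  snd : G

instance (hχ : IsDatum χ τ) : CommMonoid (TwistedProd hχ) where
  mul x y := ⟨x.fst * y.fst * χ x.snd y.snd, x.snd * y.snd⟩
  one := ⟨1, 1⟩
  mul_assoc x y z := by
    refine TwistedProd.ext ?_ (mul_assoc _ _ _)
    change x.fst * y.fst * χ x.snd y.snd * z.fst * χ (x.snd * y.snd) z.snd =
      x.fst * (y.fst * z.fst * χ y.snd z.snd) * χ x.snd (y.snd * z.snd)
    rw [hχ.mul_left, hχ.mul_right]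
    ring
  one_mul x := by
    refine TwistedProd.ext ?_ (one_mul _)
    change 1 * x.fst * χ 1 x.snd = x.fst
    rw [hχ.one_left]
    ring
  mul_one x := by
    refine TwistedProd.ext ?_ (mul_one _)
    change x.fst * 1 * χ x.snd 1 = x.fst
    rw [hχ.one_right]
    ring
  mul_comm x y := by
    refine TwistedProd.ext ?_ (mul_comm _ _)
    change x.fst * y.fst * χ x.snd y.snd = y.fst * x.fst * χ y.snd x.snd
    rw [hχ.symm]
    ring

/-- The projection of `TwistedProd` to the group. -/
def TwistedProd.toGroup (hχ : IsDatum χ τ) : TwistedProd hχ →* G where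
  toFun := TwistedProd.snd
  map_one' := rfl
  map_mul' _ _ := rfl

namespace IsDatum

/-- A quadratic refinement with prescribed values on a basis of `G`. -/
lemma exists_isQuadratic (hχ : IsDatum χ τ) (hG : IsElementaryTwo G)
    (g : Fin (Group.rank G) → G) (hg : Subgroup.closure (Set.range g) = ⊤)
    (s : Fin (Group.rank G) → R) (hs : ∀ i, s i * s i = χ (g i) (g i)) :
    ∃ σ : G → R, IsQuadratic χ σ ∧ ∀ i, σ (g i) = s i := by
  have hsq : ∀ x : G, x * x = 1 := fun x => by rw [← sq, hG]
  let z : Fin (Group.rank G) → TwistedProd hχ := fun i => ⟨s i, g i⟩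
  have hz : ∀ i, z i * z i = 1 := by
    intro i
    refine TwistedProd.ext ?_ (hsq (g i))
    change s i * s i * χ (g i) (g i) = 1
    rw [hs, hχ.chi_sq hG]
  have hzg : ∀ e, (boolProd z e).snd = boolProd g e := by
    intro e
    change TwistedProd.toGroup hχ (boolProd z e) = _
    rw [boolProd, map_prod, boolProd]
    refine Finset.prod_congr rfl fun i _ => ?_
    split_ifs
    · rfl
    · rfl
  let P := Equiv.ofBijective _ (boolProd_bijective hG g hg)
  have hP : ∀ e, P e = boolProd g e := fun _ => rfl
  have hmul : ∀ a b, (boolProd z (P.symm (a * b))).fst =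
      (boolProd z (P.symm a)).fst * (boolProd z (P.symm b)).fst * χ a b := by
    intro a b
    have e : P.symm (a * b) = fun i => xor (P.symm a i) (P.symm b i) := by
      rw [Equiv.symm_apply_eq, hP, ← boolProd_mul fun i => hsq _, ← hP, ← hP, P.apply_symm_apply,
        P.apply_symm_apply]
    rw [e, ← boolProd_mul hz]
    change _ * _ * χ (boolProd z (P.symm a)).snd (boolProd z (P.symm b)).snd = _
    rw [hzg, hzg, ← hP, ← hP, P.apply_symm_apply, P.apply_symm_apply]
  have hone : (boolProd z (P.symm 1)).fst = 1 := by
    have : P.symm 1 = fun _ => false := by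
      rw [Equiv.symm_apply_eq, hP]
      simp [boolProd]
    rw [this]
    simp only [boolProd]
    simp
    rfl
  refine ⟨fun a => (boolProd z (P.symm a)).fst, ⟨fun a => ?_, hmul⟩, fun i => ?_⟩
  · have := hmul a a
    rw [hsq, hone] at this
    have h2 := hχ.chi_sq hG a a
    linear_combination -(χ a a) * this -
      (boolProd z (P.symm a)).fst * (boolProd z (P.symm a)).fst * h2
  · have : P.symm (g i) = fun j => decide (j = i) := by
      rw [Equiv.symm_apply_eq, hP, boolProd_single]
    simp only [this, boolProd_single]
    rfl

end IsDatum

namespace IsQuadratic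

variable {σ : G → R}

lemma eq_of_closure (h : IsQuadratic χ σ) (hχ : IsDatum χ τ) (hG : IsElementaryTwo G)
    {σ' : G → R} (h' : IsQuadratic χ σ') {T : Set G} (hT : Subgroup.closure T = ⊤)
    (e : ∀ a ∈ T, σ a = σ' a) : σ = σ' := by
  funext x
  have hx : x ∈ Subgroup.closure T := by rw [hT]; trivial
  induction hx using Subgroup.closure_induction with
  | mem x hx => exact e x hx
  | one => rw [h.one hχ, h'.one hχ]
  | mul x y _ _ hx hy => rw [h.mul, h'.mul, hx, hy]
  | inv x _ hx =>
    have : x⁻¹ = x := inv_eq_of_mul_eq_one_left (by rw [← pow_two, hG])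
    rw [this, hx]

/-- The square of the normalized Gauss sum is a value of the quadratic refinement, namely at the
element `k` that represents the character `a ↦ χ(a, a)`. This avoids the classification of forms.
That `k` exists follows from the Gauss sum being nonzero. -/
lemma exists_gauss_sq [IsDomain R] (h : IsQuadratic χ σ) (hχ : IsDatum χ τ)
    (hG : IsElementaryTwo G) : ∃ k, (τ * ∑ a, σ a) ^ 2 = σ k := by
  classical
  have hcard : (Fintype.card G : R) ≠ 0 := fun h0 => by
    have := hχ.tau_sq
    rw [h0, mul_zero] at this
    exact zero_ne_one this
  have hinner : ∀ c, ∑ a, χ a a * χ a c =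
      if ∀ a, χ a a * χ a c = 1 then (Fintype.card G : R) else 0 := by
    intro c
    split_ifs with hc
    · simp [hc]
    · push Not at hc
      obtain ⟨b, hb⟩ := hc
      have e : ∑ a, χ a a * χ a c = (χ b b * χ b c) * ∑ a, χ a a * χ a c := by
        refine (Fintype.sum_equiv (Equiv.mulRight b)
          (fun a => χ (a * b) (a * b) * χ (a * b) c) _ fun _ => rfl).symm.trans ?_
        rw [Finset.mul_sum]
        refine Finset.sum_congr rfl fun a _ => ?_
        rw [hχ.mul_left, hχ.mul_left, hχ.mul_right, hχ.mul_right, hχ.symm b a]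
        linear_combination (χ a a * χ b b * χ a c * χ b c) * hχ.chi_sq hG a b
      have e2 : (1 - χ b b * χ b c) * ∑ a, χ a a * χ a c = 0 := by linear_combination e
      rcases mul_eq_zero.1 e2 with h0 | h0
      · exact absurd (sub_eq_zero.1 h0).symm hb
      · exact h0
  have hSS : (∑ a, σ a) * ∑ a, σ a = ∑ c, σ c * ∑ a, χ a a * χ a c := by
    have e1 : ∀ a, σ a * ∑ c, σ c = ∑ c, σ c * (χ a a * χ a c) := by
      intro a
      rw [← Fintype.sum_equiv (Equiv.mulLeft a) (fun c => σ (a * c)) σ fun _ => rfl,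
        Finset.mul_sum]
      refine Finset.sum_congr rfl fun c _ => ?_
      rw [h.mul]
      linear_combination σ c * χ a c * h.sq a
    rw [Finset.sum_mul, Finset.sum_congr rfl fun a _ => e1 a, Finset.sum_comm]
    simp only [Finset.mul_sum]
  have hS0 : ∑ a, σ a ≠ 0 := fun h0 => by
    have := h.gauss_mul hχ (hχ.chi_sq hG)
    rw [h0, zero_mul] at this
    exact hcard this.symm
  obtain ⟨k, hk⟩ : ∃ k, ∀ a, χ a a * χ a k = 1 := by
    by_contra hno
    push Not at hno
    refine mul_ne_zero hS0 hS0 ?_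
    rw [hSS]
    refine Finset.sum_eq_zero fun c _ => ?_
    rw [hinner, if_neg (by push Not; exact hno c), mul_zero]
  refine ⟨k, ?_⟩
  rw [mul_pow, pow_two (∑ a, σ a), hSS, Fintype.sum_eq_single k]
  · rw [hinner, if_pos hk]
    linear_combination σ k * hχ.tau_sq
  · intro c hc
    rw [hinner, if_neg, mul_zero]
    intro hc'
    refine hc (mul_inv_eq_one.1 (hχ.eq_one_of_forall fun a => ?_))
    have e1 := hχ.inv_right_mul a k
    have e2 : χ a c = χ a k := by
      linear_combination χ a a * hc' a - χ a a * hk a - (χ a c - χ a k) * hχ.chi_sq hG a a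
    rw [hχ.mul_right, e2, mul_comm, e1]

/-- The normalized Gauss sum is a root of unity of order dividing `4|G|`, hence the square of a root
of unity of order dividing `8|G|`. -/
lemma isSquare_gauss [IsDomain R] (h : IsQuadratic χ σ) (hχ : IsDatum χ τ)
    (hG : IsElementaryTwo G) {ζ : R} (hζ : IsPrimitiveRoot ζ (8 * Fintype.card G)) :
    IsSquare (τ * ∑ a, σ a) := by
  obtain ⟨k, hk⟩ := h.exists_gauss_sq hχ hG
  have hcard : 0 < Fintype.card G := Fintype.card_pos
  have hpow : (τ * ∑ a, σ a) ^ (4 * Fintype.card G) = 1 := by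
    by_cases hG1 : ∀ g : G, g = 1
    · rw [hG1 k, h.one hχ] at hk
      rw [show 4 * Fintype.card G = 2 * (2 * Fintype.card G) by ring, pow_mul, hk, one_pow]
    · push Not at hG1
      obtain ⟨g, hg⟩ := hG1
      have h2 : 2 ∣ Fintype.card G := by
        rw [← orderOf_eq_prime (hG g) hg]
        exact orderOf_dvd_card
      obtain ⟨d, hd⟩ := h2
      have h4 : σ k ^ 4 = 1 := by
        linear_combination (σ k * σ k + χ k k) * h.sq k + hχ.chi_sq hG k k
      rw [hd, show 4 * (2 * d) = 2 * (4 * d) by ring, pow_mul, hk, pow_mul, h4, one_pow]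
  have hζ2 : IsPrimitiveRoot (ζ ^ 2) (4 * Fintype.card G) := hζ.pow (by omega) (by ring)
  have : NeZero (4 * Fintype.card G) := ⟨by omega⟩
  obtain ⟨i, -, hi⟩ := hζ2.eq_pow_of_pow_eq_one hpow
  exact ⟨ζ ^ i, by rw [← hi]; ring⟩

lemma isBraidData (h : IsQuadratic χ σ) (hχ : IsDatum χ τ) (hG : IsElementaryTwo G) {s : R}
    (hs : s * s = τ * ∑ a, σ a) : IsBraidData χ τ σ s :=
  ⟨h, hχ.chi_sq hG, hs⟩

end IsQuadratic

/-- The values `χ(a, a)` are `±1`, and `R` contains a primitive fourth root of unity. -/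
lemma IsDatum.isSquare_self [IsDomain R] (hχ : IsDatum χ τ) (hG : IsElementaryTwo G) {ζ : R}
    (hζ : IsPrimitiveRoot ζ (8 * Fintype.card G)) (a : G) : IsSquare (χ a a) := by
  have hcard : 0 < Fintype.card G := Fintype.card_pos
  have hi : IsPrimitiveRoot (ζ ^ (2 * Fintype.card G)) 4 := hζ.pow (by omega) (by ring)
  have hi2 : (ζ ^ (2 * Fintype.card G)) ^ 2 = -1 := by
    have := (hi.pow (by norm_num) (show 4 = 2 * 2 by norm_num)).eq_neg_one_of_two_right
    exact this
  rcases mul_self_eq_one_iff.1 (hχ.chi_sq hG a a) with e | e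
  · rw [e]; exact IsSquare.one
  · rw [e, ← hi2]; exact ⟨_, sq _⟩

end Quadratic

/-! ### Near-group categories and their scalars -/

section Existence

variable {C : Type u} [Category.{v} C] [Preadditive C] {I : Type t} [Fintype I] {S : I → C}

lemma exists_decomposition_single {A : C} {i : I} (e : A ≅ S i) :
    ∃ (p : ∀ j, A ⟶ S j) (q : ∀ j, S j ⟶ A), (∀ j, j ≠ i → p j = 0) ∧ (∀ j, j ≠ i → q j = 0) ∧
      q i ≫ p i = 𝟙 _ ∧ ∑ j, p j ≫ q j = 𝟙 _ := by
  classical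
  refine ⟨Function.update (fun _ => 0) i e.hom, Function.update (fun _ => 0) i e.inv,
    fun j hj => Function.update_of_ne hj _ _, fun j hj => Function.update_of_ne hj _ _, ?_, ?_⟩
  · simp
  · rw [Fintype.sum_eq_single i]
    · simp
    · intro j hj
      rw [Function.update_of_ne hj, zero_comp]

end Existence

variable {R : Type w} [CommRing R] {G : Type t} [CommGroup G] [Fintype G]
  {C : Type u} [Category.{v} C] [Preadditive C] [Linear R C] [HasFiniteBiproducts C]
  [MonoidalCategory C]

namespace NearGroupCategory

/-- The simple objects of a near-group category, indexed by `Option G` with `none` for `m`. -/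
abbrev simple (N : NearGroupCategory R G C) (x : Option G) : C := x.elim N.m N.obj

lemma exists_fusionBasis (N : NearGroupCategory R G C) :
    Nonempty (FusionBasis N.simple (Fusion (G := G))) := by
  have key : ∀ s t : Option G, ∃ (p : ∀ u, N.simple s ⊗ N.simple t ⟶ N.simple u)
      (q : ∀ u, N.simple u ⟶ N.simple s ⊗ N.simple t),
      (∀ u, ¬ Fusion s t u → p u = 0) ∧ (∀ u, ¬ Fusion s t u → q u = 0) ∧
      (∀ u, Fusion s t u → q u ≫ p u = 𝟙 _) ∧ ∑ u, p u ≫ q u = 𝟙 _ := by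
    have single : ∀ {s t u : Option G} (_ : N.simple s ⊗ N.simple t ≅ N.simple u)
        (_ : ∀ u', Fusion s t u' ↔ u' = u), ∃ (p : ∀ u, N.simple s ⊗ N.simple t ⟶ N.simple u)
        (q : ∀ u, N.simple u ⟶ N.simple s ⊗ N.simple t),
        (∀ u, ¬ Fusion s t u → p u = 0) ∧ (∀ u, ¬ Fusion s t u → q u = 0) ∧
        (∀ u, Fusion s t u → q u ≫ p u = 𝟙 _) ∧ ∑ u, p u ≫ q u = 𝟙 _ := by
      intro s t u e hu
      obtain ⟨p, q, hp, hq, h1, h2⟩ := exists_decomposition_single (S := N.simple) e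
      refine ⟨p, q, fun u' h => hp _ fun h' => h ((hu _).2 h'),
        fun u' h => hq _ fun h' => h ((hu _).2 h'), fun u' h => ?_, h2⟩
      obtain rfl := (hu u').1 h
      exact h1
    rintro (_ | a) (_ | b)
    · obtain ⟨e⟩ := N.m_tensor_m
      refine ⟨fun u => match u with
          | none => 0
          | some g => e.hom ≫ biproduct.π N.obj g,
        fun u => match u with
          | none => 0
          | some g => biproduct.ι N.obj g ≫ e.inv, ?_, ?_, ?_, ?_⟩
      · rintro (_ | g) hg
        · rfl
        · exact absurd fusion_none hg
      · rintro (_ | g) hg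
        · rfl
        · exact absurd fusion_none hg
      · rintro (_ | g) hg
        · exact False.elim hg
        · change (biproduct.ι N.obj g ≫ e.inv) ≫ e.hom ≫ biproduct.π N.obj g = 𝟙 (N.obj g)
          simp
      · rw [Fintype.sum_option]
        change (0 : N.m ⊗ N.m ⟶ N.m) ≫ (0 : N.m ⟶ N.m ⊗ N.m) +
          ∑ g, (e.hom ≫ biproduct.π N.obj g) ≫ biproduct.ι N.obj g ≫ e.inv = 𝟙 (N.m ⊗ N.m)
        have h1 : ∑ g, (e.hom ≫ biproduct.π N.obj g) ≫ biproduct.ι N.obj g ≫ e.inv =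
            e.hom ≫ (∑ g, biproduct.π N.obj g ≫ biproduct.ι N.obj g) ≫ e.inv := by
          simp only [Preadditive.sum_comp, Preadditive.comp_sum, Category.assoc]
        have h2 : ∑ g, biproduct.π N.obj g ≫ biproduct.ι N.obj g = 𝟙 _ := by
          classical
          refine biproduct.hom_ext _ _ fun j => ?_
          rw [Preadditive.sum_comp, Fintype.sum_eq_single j]
          · simp
          · intro j' hj'
            rw [Category.assoc, biproduct.ι_π_ne _ hj', comp_zero]
        rw [h1, h2]
        simp
    · obtain ⟨e⟩ := N.m_tensor_obj b
      exact single (u := none) e (by rintro (_ | g) <;> simp)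
    · obtain ⟨e⟩ := N.obj_tensor_m a
      exact single (u := none) e (by rintro (_ | g) <;> simp)
    · obtain ⟨e⟩ := N.obj_tensor_obj a b
      exact single (u := some (a * b)) e (by rintro (_ | g) <;> simp [eq_comm])
  choose p q hp hq hqp hpq using key
  exact ⟨⟨p, q, hp, hq, hqp, hpq⟩⟩

variable [MonoidalPreadditive C] [MonoidalLinear R C]

/-- A near-group category has a fusion basis whose associativity symbols are in normal form. -/
theorem exists_normalForm [IsDomain R] (N : NearGroupCategory R G C) :
    ∃ (V : FusionBasis N.simple (Fusion (G := G))) (χ : G → G → R) (τ : R), IsDatum χ τ ∧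
      V.assocSymbol N.semisimple = normalForm χ τ := by
  obtain ⟨V₀⟩ := N.exists_fusionBasis
  obtain ⟨V, hV⟩ := V₀.exists_isNormalized N.semisimple
  obtain ⟨χ, τ, h1, h2⟩ := (V.isAssocSymbol N.semisimple).exists_eq_normalForm hV
  exact ⟨V, χ, τ, h1, h2⟩

end NearGroupCategory

namespace FusionBasis

variable [MonoidalPreadditive C] [MonoidalLinear R C] {S : Option G → C}

lemma exists_smul (V : FusionBasis S (Fusion (G := G))) (h : IsSemisimple R S) {s t u : Option G}
    (f : S s ⊗ S t ⟶ S u) : ∃ x : R, f = x • V.v s t u :=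
  ⟨_, V.eq_scalar_smul h f⟩

lemma smul_middle_injective (V : FusionBasis S (Fusion (G := G))) (h : IsSemisimple R S) {a : G}
    {x y : R} (e : x • ((V.v none (some a) none ▷ S none) ≫ V.v none none (some 1)) =
      y • ((V.v none (some a) none ▷ S none) ≫ V.v none none (some 1))) : x = y := by
  have e' := congrArg (fun f => V.w none none (some 1) ≫ (V.w none (some a) none ▷ S none) ≫ f) e
  have key : V.w none none (some 1) ≫ (V.w none (some a) none ▷ S none) ≫
      (V.v none (some a) none ▷ S none) ≫ V.v none none (some 1) = 𝟙 (S (some 1)) := by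
    rw [← comp_whiskerRight_assoc, V.w_v _ _ _ fusion_right, id_whiskerRight, Category.id_comp,
      V.w_v _ _ _ fusion_none]
  simp only [Linear.comp_smul, key] at e'
  exact h.smul_id_injective e'

variable (V : FusionBasis S (Fusion (G := G))) (h : IsSemisimple R S) {χ : G → G → R} {τ : R}

lemma chi_spec (hV : V.assocSymbol h = normalForm χ τ) (a b : G)
    (l : S (some a) ⊗ S none ⟶ S none) (r : S none ⊗ S (some b) ⟶ S none) :
    (α_ (S (some a)) (S none) (S (some b))).hom ≫ (S (some a) ◁ r) ≫ l =
      χ a b • ((l ▷ S (some b)) ≫ r) := by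
  obtain ⟨x, rfl⟩ := V.exists_smul h l
  obtain ⟨y, rfl⟩ := V.exists_smul h r
  have e := V.assoc_comp_single h (some a) none (some b) none none none (by
    rintro (_ | p) hp
    · exact absurd rfl hp
    · rw [hV]; rfl)
  rw [hV] at e
  simp only [MonoidalLinear.whiskerLeft_smul, MonoidalLinear.smul_whiskerRight, Linear.comp_smul,
    Linear.smul_comp, e]
  simp only [normalForm, smul_smul]
  congr 1
  ring

/-- The normalization of `Hom(m a, m)`: the associator `(m a) m → m (a m)` is the identity on the
unit summand. -/
lemma assoc_middle (hχ : IsDatum χ τ) (hV : V.assocSymbol h = normalForm χ τ) (a : G) :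
    (α_ (S none) (S (some a)) (S none)).hom ≫ (S none ◁ V.v (some a) none none) ≫
      V.v none none (some 1) = (V.v none (some a) none ▷ S none) ≫ V.v none none (some 1) := by
  have e := V.assoc_comp_single h none (some a) none (some 1) none none (by
    rintro (_ | p) hp
    · exact absurd rfl hp
    · rw [hV]; rfl)
  rw [hV] at e
  simpa only [normalForm, hχ.one_left, one_smul] using e

/-- The basis elements of `Hom(a m, m)` and `Hom(m a, m)` are normalized as the definition of
`σ₁(a)` requires. -/
lemma v_normalized (hχ : IsDatum χ τ) (hV : V.assocSymbol h = normalForm χ τ)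
    (e : 𝟙_ C ≅ S (some 1)) (a : G) (p : S none ⊗ S none ⟶ 𝟙_ C) :
    (V.v none (some a) none ▷ S none) ≫ p = (α_ (S none) (S (some a)) (S none)).hom ≫
      (S none ◁ V.v (some a) none none) ≫ p := by
  obtain ⟨x, hx⟩ := V.exists_smul h (p ≫ e.hom)
  rw [← cancel_mono e.hom]
  simp only [Category.assoc, hx, Linear.comp_smul, V.assoc_middle h hχ hV]

lemma sigmaOne_spec (hχ : IsDatum χ τ) (hV : V.assocSymbol h = normalForm χ τ)
    (e : 𝟙_ C ≅ S (some 1)) (c : BraidedCategory C) (a : G)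
    (l : S (some a) ⊗ S none ⟶ S none) (r : S none ⊗ S (some a) ⟶ S none)
    (hlr : ∀ p : S none ⊗ S none ⟶ 𝟙_ C, (r ▷ S none) ≫ p =
      (α_ (S none) (S (some a)) (S none)).hom ≫ (S none ◁ l) ≫ p) :
    (c.braiding (S (some a)) (S none)).hom ≫ r =
      V.braidSymbol h (c.braiding (S (some a)) (S none)).hom none • l := by
  obtain ⟨x, rfl⟩ := V.exists_smul h l
  obtain ⟨y, rfl⟩ := V.exists_smul h r
  have h2 := congrArg (fun f => f ≫ e.hom) (hlr (V.v none none (some 1) ≫ e.inv))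
  simp only [MonoidalLinear.whiskerLeft_smul, MonoidalLinear.smul_whiskerRight, Linear.comp_smul,
    Linear.smul_comp, Category.assoc, e.inv_hom_id, Category.comp_id,
    V.assoc_middle h hχ hV] at h2
  obtain rfl := V.smul_middle_injective h h2
  rw [Linear.comp_smul, smul_comm, V.comp_v h]

lemma sigmaThree_spec (e : 𝟙_ C ≅ S (some 1)) (c : BraidedCategory C)
    (p : S none ⊗ S none ⟶ 𝟙_ C) :
    (c.braiding (S none) (S none)).hom ≫ p =
      V.braidSymbol h (c.braiding (S none) (S none)).hom (some 1) • p := by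
  obtain ⟨x, hx⟩ := V.exists_smul h (p ≫ e.hom)
  rw [← cancel_mono e.hom, Category.assoc, Linear.smul_comp, hx, Linear.comp_smul, smul_comm,
    V.comp_v h]

/-- The scalars of `i` and `p` are inverse to each other, and those of the two unit constraints
agree in the normalized basis, by the triangle identity. -/
lemma tau_spec (hχ : IsDatum χ τ) (hV : V.assocSymbol h = normalForm χ τ)
    (e : 𝟙_ C ≅ S (some 1)) (i : 𝟙_ C ⟶ S none ⊗ S none) (p : S none ⊗ S none ⟶ 𝟙_ C)
    (hip : i ≫ p = 𝟙 (𝟙_ C)) :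
    (λ_ (S none)).inv ≫ (i ▷ S none) ≫ (α_ (S none) (S none) (S none)).hom ≫ (S none ◁ p) ≫
      (ρ_ (S none)).hom = τ • 𝟙 (S none) := by
  obtain ⟨x, hx⟩ := V.exists_smul h (p ≫ e.hom)
  obtain ⟨y, hy⟩ : ∃ y : R, (e.inv ≫ i) ≫ V.v none none (some 1) = y • 𝟙 _ :=
    ⟨_, (h.scalar_smul _).symm⟩
  obtain ⟨z, hz⟩ := V.exists_smul h ((S none ◁ e.inv) ≫ (ρ_ (S none)).hom)
  obtain ⟨z', hz'⟩ := V.exists_smul h ((e.inv ▷ S none) ≫ (λ_ (S none)).hom)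
  have hxy : y * x = 1 := by
    have h1 : (e.inv ≫ i) ≫ p ≫ e.hom = 𝟙 _ := by
      rw [Category.assoc, reassoc_of% hip, e.inv_hom_id]
    rw [hx, Linear.comp_smul, hy, smul_smul] at h1
    rw [mul_comm]
    exact h.smul_id_injective (by rw [one_smul]; exact h1)
  -- the triangle identity compares the two unit constraints
  have hzz : z = z' := by
    have h1 : (α_ (S none) (S (some 1)) (S none)).hom ≫
        (S none ◁ ((e.inv ▷ S none) ≫ (λ_ (S none)).hom)) =
        ((S none ◁ e.inv) ≫ (ρ_ (S none)).hom) ▷ S none := by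
      rw [comp_whiskerRight, ← triangle, MonoidalCategory.whiskerLeft_comp,
        whisker_assoc_symm]
      simp
    have h2 := congrArg (fun f => f ≫ V.v none none (some 1)) h1
    simp only [hz, hz', MonoidalLinear.whiskerLeft_smul, MonoidalLinear.smul_whiskerRight,
      Linear.comp_smul, Linear.smul_comp, Category.assoc, V.assoc_middle h hχ hV] at h2
    exact (V.smul_middle_injective h h2).symm
  subst hzz
  have hp : (S none ◁ p) ≫ (ρ_ (S none)).hom =
      (x * z) • ((S none ◁ V.v none none (some 1)) ≫ V.v none (some 1) none) := by
    have : p = (x • V.v none none (some 1)) ≫ e.inv := by rw [← hx]; simp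
    rw [this, MonoidalCategory.whiskerLeft_comp, Category.assoc, hz,
      MonoidalLinear.whiskerLeft_smul, Linear.smul_comp, Linear.comp_smul, smul_smul]
  have hF := V.assoc_comp h none none none none (some 1)
  rw [hV, Fintype.sum_option] at hF
  simp only [normalForm, zero_smul, zero_add, inv_one, hχ.one_right, mul_one] at hF
  have hi : (e.inv ▷ S none) ≫ (i ▷ S none) ≫ (α_ (S none) (S none) (S none)).hom ≫
      (S none ◁ V.v none none (some 1)) ≫ V.v none (some 1) none =
      (y * τ) • V.v (some 1) none none := by
    rw [hF, ← comp_whiskerRight_assoc]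
    simp only [Preadditive.comp_sum, Linear.comp_smul, ← comp_whiskerRight_assoc]
    rw [Fintype.sum_eq_single 1]
    · rw [hy, MonoidalLinear.smul_whiskerRight, Linear.smul_comp, id_whiskerRight,
        Category.id_comp, smul_smul, mul_comm]
    · intro g hg
      rw [h.hom_eq_zero _ _ (by simpa using hg.symm) ((e.inv ≫ i) ≫ V.v none none (some g))]
      simp
  rw [← cancel_epi ((e.inv ▷ S none) ≫ (λ_ (S none)).hom)]
  rw [Linear.comp_smul, Category.comp_id, hz', hp]
  rw [← hz']
  simp only [Category.assoc, Iso.hom_inv_id_assoc, Linear.comp_smul, hi]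
  rw [hz', smul_smul, smul_smul]
  congr 1
  linear_combination z * τ * hxy

end FusionBasis

/-! ### Twists -/

section Twist

variable {R : Type w} [CommRing R] {G : Type t} [CommGroup G] [Fintype G]
  {C : Type u} [Category.{v} C] [Preadditive C] [Linear R C] [HasFiniteBiproducts C]
  [MonoidalCategory C] [MonoidalPreadditive C] [MonoidalLinear R C]
  {I : Type t} [Fintype I] {S : I → C} {N : I → I → I → Prop}

/-- The component of a twist at `X`. -/
def Twist.hom {c : BraidedCategory C} (T : Twist c) (X : C) : X ⟶ X := T.θ.hom.app X

lemma Twist.naturality {c : BraidedCategory C} (T : Twist c) {X Y : C} (f : X ⟶ Y) :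
    f ≫ T.hom Y = T.hom X ≫ f :=
  T.θ.hom.naturality f

lemma Twist.hom_tensor {c : BraidedCategory C} (T : Twist c) (X Y : C) : T.hom (X ⊗ Y) =
    (c.braiding X Y).hom ≫ (c.braiding Y X).hom ≫ (T.hom X ⊗ₘ T.hom Y) :=
  T.balance X Y

namespace FusionBasis

/-- The scalars by which a twist acts on the simple objects. -/
noncomputable def twistScalar (h : IsSemisimple R S) {c : BraidedCategory C} (T : Twist c)
    (s : I) : R :=
  h.scalar (T.hom (S s))

lemma twist_hom (h : IsSemisimple R S) {c : BraidedCategory C} (T : Twist c) (s : I) :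
    T.hom (S s) = twistScalar h T s • 𝟙 (S s) :=
  (h.scalar_smul _).symm

lemma isUnit_twistScalar (h : IsSemisimple R S) {c : BraidedCategory C} (T : Twist c) (s : I) :
    IsUnit (twistScalar h T s) := by
  have h1 : T.hom (S s) ≫ (T.θ.inv.app (S s) : S s ⟶ S s) = 𝟙 (S s) :=
    congrArg (fun f => f.app (S s)) T.θ.hom_inv_id
  refine IsUnit.of_mul_eq_one (h.scalar (T.θ.inv.app (S s) : S s ⟶ S s))
    (h.smul_id_injective (i := s) ?_)
  rw [twist_hom h, Linear.smul_comp, Category.id_comp] at h1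
  rw [mul_smul, h.scalar_smul, h1, one_smul]

/-- The balancing equation in coordinates. -/
lemma twistScalar_eq (V : FusionBasis S N) (h : IsSemisimple R S) {c : BraidedCategory C}
    (T : Twist c) {s t u : I} (hN : N s t u) :
    twistScalar h T u = V.braidSymbol h (c.braiding (S s) (S t)).hom u *
      V.braidSymbol h (c.braiding (S t) (S s)).hom u * (twistScalar h T s * twistScalar h T t) := by
  refine V.smul_v_injective h hN ?_
  have h1 : T.hom (S s ⊗ S t) ≫ V.v s t u = twistScalar h T u • V.v s t u := by
    rw [← T.naturality, twist_hom h, Linear.comp_smul, Category.comp_id]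
  rw [← h1, T.hom_tensor, twist_hom h, twist_hom h, IsSemisimple.smul_tensorHom,
    IsSemisimple.tensorHom_smul, id_tensorHom_id]
  simp only [Linear.comp_smul, Linear.smul_comp, Category.comp_id, Category.assoc, V.comp_v h,
    smul_smul]
  congr 1
  ring

/-- A twist is determined by its scalars on the simple objects. -/
lemma twist_ext (h : IsSemisimple R S) {c : BraidedCategory C} {T T' : Twist c}
    (e : ∀ s, twistScalar h T s = twistScalar h T' s) : T = T' := by
  have key : ∀ X, T.hom X = T'.hom X := fun X => h.hom_ext fun s x => by
    rw [← T.naturality, ← T'.naturality, twist_hom h, twist_hom h, e]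
  have hθ : T.θ = T'.θ := Iso.ext (NatTrans.ext (funext key))
  obtain ⟨θ, _⟩ := T
  obtain ⟨θ', _⟩ := T'
  obtain rfl : θ = θ' := hθ
  rfl

/-- The automorphism of `X` that acts on the `s`-isotypic part as the unit `x s`. -/
noncomputable def diagIso (h : IsSemisimple R S) {x y : I → R} (hxy : ∀ s, x s * y s = 1)
    (X : C) : X ≅ X where
  hom := h.diag x X
  inv := h.diag y X
  hom_inv_id := h.hom_ext fun s f => by
    rw [Category.assoc, h.diag_comp, h.diag_comp, smul_smul, hxy, one_smul, Category.id_comp]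
  inv_hom_id := h.hom_ext fun s f => by
    rw [Category.assoc, h.diag_comp, h.diag_comp, smul_smul, mul_comm, hxy, one_smul,
      Category.id_comp]

/-- A family of units that satisfies the balancing equation in coordinates is the family of scalars
of a twist. -/
lemma exists_twist (V : FusionBasis S N) (h : IsSemisimple R S) (c : BraidedCategory C)
    {x y : I → R} (hxy : ∀ s, x s * y s = 1)
    (hx : ∀ s t u, N s t u → x u = V.braidSymbol h (c.braiding (S s) (S t)).hom u *
      V.braidSymbol h (c.braiding (S t) (S s)).hom u * (x s * x t)) :
    ∃ T : Twist c, ∀ s, twistScalar h T s = x s := by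
  have bal : ∀ X Y, h.diag x (X ⊗ Y) =
      (c.braiding X Y).hom ≫ (c.braiding Y X).hom ≫ (h.diag x X ⊗ₘ h.diag x Y) := by
    intro X Y
    refine h.hom_ext_tensor fun s t f g => ?_
    rw [← h.diag_naturality, Category.assoc, Category.assoc, tensorHom_comp_tensorHom, h.diag_comp,
      h.diag_comp, IsSemisimple.smul_tensorHom, IsSemisimple.tensorHom_smul]
    simp only [Linear.comp_smul]
    rw [← @BraidedCategory.braiding_naturality _ _ _ c,
      ← @BraidedCategory.braiding_naturality_assoc _ _ _ c]
    simp only [← Linear.comp_smul]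
    congr 1
    refine V.hom_ext fun u => ?_
    rw [h.diag_comp]
    simp only [Linear.smul_comp, Category.assoc, V.comp_v h, Linear.comp_smul, smul_smul]
    by_cases hN : N s t u
    · rw [hx s t u hN]
      congr 1
      ring
    · rw [V.v_eq_zero _ _ _ hN, smul_zero, smul_zero]
  refine ⟨⟨NatIso.ofComponents (fun X => (diagIso h hxy X : (𝟭 C).obj X ≅ (𝟭 C).obj X))
    fun f => h.diag_naturality x f, fun X Y => bal X Y⟩, fun s => ?_⟩
  have e : h.diag x (S s) = x s • 𝟙 (S s) := by
    rw [← Category.comp_id (h.diag x (S s)), h.diag_comp]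
  change h.scalar (h.diag x (S s)) = x s
  rw [e, h.scalar_smul_id]

end FusionBasis

end Twist

/-! ### Invariance under equivalence -/

section Equivalence

variable {R : Type w} [CommRing R] {G : Type t} [Group G] [Finite G]
  {C : Type u} [Category.{v} C] [Preadditive C] [Linear R C] [HasFiniteBiproducts C]
  [MonoidalCategory C]

open Functor.LaxMonoidal Functor.OplaxMonoidal

lemma BraidingsEquivalent.refl (N : NearGroupCategory R G C) (c : BraidedCategory C) :
    BraidingsEquivalent N c c :=
  ⟨𝟭 C, inferInstance, inferInstance, inferInstance, inferInstance, fun _ => ⟨Iso.refl _⟩,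
    ⟨Iso.refl _⟩, fun X Y => by simp⟩

/-- The scalar `σ₃(1)` is an invariant: every `p' : m m ⟶ 1` is the image under the equivalence, up
to its structure isomorphisms, of some `p : m m ⟶ 1`. -/
lemma IsSigmaThree.of_equivalent {N : NearGroupCategory R G C} {c c' : BraidedCategory C} {x : R}
    (hx : IsSigmaThree N c x) (H : BraidingsEquivalent N c c') : IsSigmaThree N c' x := by
  obtain ⟨F, _, _, _, _, -, ⟨φ⟩, hF⟩ := H
  intro p'
  obtain ⟨p, hp⟩ := F.map_surjective (δ F N.m N.m ≫ (φ.hom ⊗ₘ φ.hom) ≫ p' ≫ ε F)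
  have h1 := congrArg (fun f => μ F N.m N.m ≫ F.map f) (hx p)
  simp only [F.map_comp, F.map_smul, hp] at h1
  rw [← Category.assoc, hF] at h1
  simp only [Category.assoc, Functor.Monoidal.μ_δ_assoc, Linear.comp_smul] at h1
  rw [← @BraidedCategory.braiding_naturality_assoc _ _ _ c'] at h1
  rw [← cancel_epi (φ.hom ⊗ₘ φ.hom), ← cancel_mono (ε F)]
  simpa using h1

/-- The scalars `σ₁(a)` are invariants, because a monoidal equivalence preserves the normalization
of pairs of elements of `Hom(a m, m)` and `Hom(m a, m)`. -/
lemma IsSigmaOne.of_equivalent {N : NearGroupCategory R G C} {c c' : BraidedCategory C} {a : G}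
    {x : R} (hx : IsSigmaOne N c a x) (H : BraidingsEquivalent N c c') : IsSigmaOne N c' a x := by
  obtain ⟨F, _, _, _, _, hφ, ⟨φ⟩, hF⟩ := H
  obtain ⟨ψ⟩ := hφ a
  intro l' r' hlr
  obtain ⟨l, hl⟩ := F.map_surjective (δ F (N.obj a) N.m ≫ (ψ.hom ⊗ₘ φ.hom) ≫ l' ≫ φ.inv)
  obtain ⟨r, hr⟩ := F.map_surjective (δ F N.m (N.obj a) ≫ (φ.hom ⊗ₘ ψ.hom) ≫ r' ≫ φ.inv)
  have h1 := hx l r fun p => F.map_injective ?_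
  · have h2 := congrArg (fun f => μ F (N.obj a) N.m ≫ F.map f) h1
    simp only [F.map_comp, F.map_smul, hl, hr] at h2
    rw [← Category.assoc, hF] at h2
    simp only [Category.assoc, Functor.Monoidal.μ_δ_assoc, Linear.comp_smul] at h2
    rw [← @BraidedCategory.braiding_naturality_assoc _ _ _ c'] at h2
    rw [← cancel_epi (ψ.hom ⊗ₘ φ.hom), ← cancel_mono φ.inv]
    simpa using h2
  · obtain ⟨p', hp'⟩ : ∃ p', F.map p = δ F N.m N.m ≫ (φ.hom ⊗ₘ φ.hom) ≫ p' ≫ ε F :=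
      ⟨(φ.inv ⊗ₘ φ.inv) ≫ μ F N.m N.m ≫ F.map p ≫ η F, by simp⟩
    have h2 : F.map (r ▷ N.m) ≫ δ F N.m N.m ≫ (φ.hom ⊗ₘ φ.hom) =
        δ F (N.m ⊗ N.obj a) N.m ≫ δ F N.m (N.obj a) ▷ F.obj N.m ≫
          ((φ.hom ⊗ₘ ψ.hom) ⊗ₘ φ.hom) ≫ r' ▷ N.m := by
      rw [← δ_natural_left_assoc, hr]
      simp only [← tensorHom_id, tensorHom_comp_tensorHom, Category.assoc, Iso.inv_hom_id,
        Category.comp_id, Category.id_comp]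
    have h3 : F.map (N.m ◁ l) ≫ δ F N.m N.m ≫ (φ.hom ⊗ₘ φ.hom) =
        δ F N.m (N.obj a ⊗ N.m) ≫ F.obj N.m ◁ δ F (N.obj a) N.m ≫
          (φ.hom ⊗ₘ (ψ.hom ⊗ₘ φ.hom)) ≫ N.m ◁ l' := by
      rw [← δ_natural_right_assoc, hl]
      simp only [← id_tensorHom, tensorHom_comp_tensorHom, Category.assoc, Iso.inv_hom_id,
        Category.comp_id, Category.id_comp]
    rw [F.map_comp, F.map_comp, F.map_comp, hp', reassoc_of% h2, reassoc_of% h3,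
      reassoc_of% hlr p']
    rw [associator_naturality_assoc, Functor.OplaxMonoidal.associativity_assoc]

end Equivalence

/-! ### Classification of the braidings and of their twists -/

section Classification

variable {R : Type w} [CommRing R] {G : Type t} [CommGroup G] [Fintype G]
  {C : Type u} [Category.{v} C] [Preadditive C] [Linear R C] [HasFiniteBiproducts C]
  [MonoidalCategory C] [MonoidalPreadditive C] [MonoidalLinear R C] {S : Option G → C}
  {χ : G → G → R} {τ : R}

namespace FusionBasis

/-- The scalar `σ₁(a)` of a braiding. -/
noncomputable def sigmaOne (V : FusionBasis S (Fusion (G := G))) (h : IsSemisimple R S)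
    (c : BraidedCategory C) (a : G) : R :=
  V.braidSymbol h (c.braiding (S (some a)) (S none)).hom none

/-- The scalar `σ₃(1)` of a braiding. -/
noncomputable def sigmaThree (V : FusionBasis S (Fusion (G := G))) (h : IsSemisimple R S)
    (c : BraidedCategory C) : R :=
  V.braidSymbol h (c.braiding (S none) (S none)).hom (some 1)

variable {V : FusionBasis S (Fusion (G := G))} {h : IsSemisimple R S}

lemma isBraidData_and_braidSymbol_eq (hχ : IsDatum χ τ) (hV : V.assocSymbol h = normalForm χ τ)
    (c : BraidedCategory C) :
    IsBraidData χ τ (V.sigmaOne h c) (V.sigmaThree h c) ∧ ∀ s t u, Fusion s t u →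
      V.braidSymbol h (c.braiding (S s) (S t)).hom u =
        braidForm χ (V.sigmaOne h c) (V.sigmaThree h c) s t u := by
  have H := V.hexagon_of_braided h c
  have H' := V.hexagon_of_braided_symm h c
  rw [hV] at H H'
  exact hχ.eq_braidForm_of_hexagon H H' fun s t u hN => V.braidSymbol_mul_symm h c hN

lemma isBraidData (hχ : IsDatum χ τ) (hV : V.assocSymbol h = normalForm χ τ)
    (c : BraidedCategory C) : IsBraidData χ τ (V.sigmaOne h c) (V.sigmaThree h c) :=
  (isBraidData_and_braidSymbol_eq hχ hV c).1

lemma braidSymbol_eq (hχ : IsDatum χ τ) (hV : V.assocSymbol h = normalForm χ τ)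
    (c : BraidedCategory C) {s t u : Option G} (hN : Fusion s t u) :
    V.braidSymbol h (c.braiding (S s) (S t)).hom u =
      braidForm χ (V.sigmaOne h c) (V.sigmaThree h c) s t u :=
  (isBraidData_and_braidSymbol_eq hχ hV c).2 s t u hN

lemma braided_eq_of_sigma_eq (hχ : IsDatum χ τ) (hV : V.assocSymbol h = normalForm χ τ)
    {c c' : BraidedCategory C} (h₁ : V.sigmaOne h c = V.sigmaOne h c')
    (h₃ : V.sigmaThree h c = V.sigmaThree h c') : c = c' :=
  V.braided_ext h fun s t u hN => by
    rw [braidSymbol_eq hχ hV c hN, braidSymbol_eq hχ hV c' hN, h₁, h₃]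

lemma exists_braided (hχ : IsDatum χ τ) (hV : V.assocSymbol h = normalForm χ τ) {σ : G → R}
    {s : R} (hσ : IsBraidData χ τ σ s) :
    ∃ c : BraidedCategory C, V.sigmaOne h c = σ ∧ V.sigmaThree h c = s := by
  obtain ⟨s', hs, hσ'⟩ := hσ.exists_inverse hχ
  have H := hσ.hexagon hχ
  have H' := hσ'.hexagon hχ
  rw [← hV] at H H'
  have hb := hσ.braidForm_mul hχ hs
  refine ⟨V.braided h (fun _ _ _ => Fusion.symm) hb H H', ?_, ?_⟩
  · funext a
    refine V.smul_v_injective h (fusion_left (a := a)) ?_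
    rw [sigmaOne, ← V.comp_v h, V.braided_comp_v]
    rfl
  · refine V.smul_v_injective h (fusion_none (a := (1 : G))) ?_
    rw [sigmaThree, ← V.comp_v h, V.braided_comp_v]
    simp [braidForm, hσ.one hχ, hχ.one_left]

/-- A twist is `χ(a, a)` on `a ∈ G`, and its scalar on `m` is one of the two square roots
`± σ₃(1)⁻¹` of `σ₃(1)⁻²`. -/
theorem card_twist [IsDomain R] (h2 : (2 : R) ≠ 0) (hχ : IsDatum χ τ)
    (hV : V.assocSymbol h = normalForm χ τ) (c : BraidedCategory C) : Nat.card (Twist c) = 2 := by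
  have hd := isBraidData hχ hV c
  obtain ⟨s', hs, -⟩ := hd.exists_inverse hχ
  have hs0 : V.sigmaThree h c ≠ 0 := left_ne_zero_of_mul_eq_one hs
  have hs0' : s' ≠ 0 := right_ne_zero_of_mul_eq_one hs
  have heq : ∀ (T : Twist c) {s t u : Option G} (_ : Fusion s t u), twistScalar h T u =
      braidForm χ (V.sigmaOne h c) (V.sigmaThree h c) s t u *
      braidForm χ (V.sigmaOne h c) (V.sigmaThree h c) t s u *
        (twistScalar h T s * twistScalar h T t) := by
    intro T s t u hN
    rw [V.twistScalar_eq h T hN, braidSymbol_eq hχ hV c hN, braidSymbol_eq hχ hV c hN.symm]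
  have hobj : ∀ (T : Twist c) a, twistScalar h T (some a) = χ a a := by
    intro T a
    have e := heq T (fusion_left (a := a))
    simp only [braidForm, hd.sq] at e
    refine (isUnit_twistScalar h T none).mul_right_cancel ?_
    linear_combination -χ a a * e - twistScalar h T (some a) * twistScalar h T none * hd.chi_sq a a
  have hm : ∀ T : Twist c, twistScalar h T none = s' ∨ twistScalar h T none = -s' := by
    intro T
    have e := heq T (fusion_none (a := 1))
    simp only [braidForm, hobj, hχ.one_left, hd.one hχ, mul_one] at e
    refine sq_eq_sq_iff_eq_or_eq_neg.1 ?_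
    refine mul_left_cancel₀ (pow_ne_zero 2 hs0) ?_
    linear_combination -e - (V.sigmaThree h c * s' + 1) * hs
  have hex : ∀ y : R, y ^ 2 = s' ^ 2 → ∃ T : Twist c, twistScalar h T none = y := by
    intro y hy
    let x : Option G → R := fun o => o.elim y fun a => χ a a
    let z : Option G → R := fun o => o.elim (V.sigmaThree h c ^ 2 * y) fun a => χ a a
    obtain ⟨T, hT⟩ := V.exists_twist h c (x := x) (y := z) (by
      rintro (_ | a)
      · change y * (V.sigmaThree h c ^ 2 * y) = 1
        linear_combination V.sigmaThree h c ^ 2 * hy + (V.sigmaThree h c * s' + 1) * hs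
      · exact hd.chi_sq a a) (by
      intro s t u hN
      rw [braidSymbol_eq hχ hV c hN, braidSymbol_eq hχ hV c hN.symm]
      rcases s with _ | a <;> rcases t with _ | b <;> rcases u with _ | d <;>
        first | exact False.elim hN | simp only [braidForm, x, Option.elim]
      · linear_combination (-(V.sigmaThree h c) ^ 2 * χ d d ^ 2 * y ^ 2) * hd.sq d
          - χ d d * (χ d d ^ 2) * (V.sigmaThree h c ^ 2 * hy + (V.sigmaThree h c * s' + 1) * hs)
          - χ d d * hd.chi_sq d d
      · linear_combination (-χ b b * y) * hd.sq b - y * hd.chi_sq b b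
      · linear_combination (-χ a a * y) * hd.sq a - y * hd.chi_sq a a
      · rw [← fusion_some.1 hN, hχ.mul_left, hχ.mul_right, hχ.mul_right, hχ.symm b a]
        ring)
    exact ⟨T, hT none⟩
  have hinj : Function.Injective fun T : Twist c => twistScalar h T none := by
    intro T T' e
    refine twist_ext h ?_
    rintro (_ | a)
    · exact e
    · rw [hobj, hobj]
  have hrange : Set.range (fun T : Twist c => twistScalar h T none) = {s', -s'} := by
    ext y
    simp only [Set.mem_range, Set.mem_insert_iff, Set.mem_singleton_iff]
    constructor
    · rintro ⟨T, rfl⟩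
      exact hm T
    · rintro (rfl | rfl)
      · exact hex _ rfl
      · exact hex _ (neg_sq _)
  rw [Nat.card_congr (Equiv.ofInjective _ hinj), hrange, Nat.card_coe_set_eq, Set.ncard_pair]
  intro e
  exact mul_ne_zero h2 hs0' (by linear_combination e)

end FusionBasis

end Classification

section Signs

variable {R : Type w} [CommRing R] [IsDomain R]

/-- Two elements of a domain with the same square differ by a sign. -/
lemma exists_sign {x y : R} (e : x * x = y ^ 2) : ∃ u : ℤˣ, x = ((u : ℤ) : R) * y := by
  rcases sq_eq_sq_iff_eq_or_eq_neg.1 ((sq x).trans e) with e | e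
  · exact ⟨1, by simp [e]⟩
  · exact ⟨-1, by simp [e]⟩

lemma sign_mul_self (u : ℤˣ) : ((u : ℤ) : R) * ((u : ℤ) : R) = 1 := by
  rcases Int.units_eq_one_or u with rfl | rfl <;> simp

lemma sign_injective (h2 : (2 : R) ≠ 0) {y : R} (hy : y ≠ 0) {u u' : ℤˣ}
    (e : ((u : ℤ) : R) * y = ((u' : ℤ) : R) * y) : u = u' := by
  have e' := mul_right_cancel₀ hy e
  have hne : (1 : R) ≠ -1 := fun h => h2 (by linear_combination h)
  rcases Int.units_eq_one_or u with rfl | rfl <;> rcases Int.units_eq_one_or u' with rfl | rfl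
  · rfl
  · exact absurd (by simpa using e') hne
  · exact absurd (by simpa using e'.symm) hne
  · rfl

lemma two_ne_zero_of_isPrimitiveRoot {n : ℕ} (hn : 0 < n) {ζ : R}
    (hζ : IsPrimitiveRoot ζ (8 * n)) : (2 : R) ≠ 0 := by
  intro h2
  have h1 : IsPrimitiveRoot (ζ ^ (4 * n)) 2 := hζ.pow (by omega) (by ring)
  have h3 := h1.eq_neg_one_of_two_right
  exact h1.ne_one (by norm_num) (by rw [h3]; linear_combination -h2)

end Signs

end NearGroup

theorem theorem1p2 {R : Type w} [CommRing R] [IsDomain R]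
    {G : Type t} [CommGroup G] [Fintype G]
    {C : Type u} [Category.{v} C] [Preadditive C] [Linear R C] [HasFiniteBiproducts C]
    [MonoidalCategory C] [MonoidalPreadditive C] [MonoidalLinear R C]
    (N : NearGroup.NearGroupCategory R G C)
    (hR : ∃ ζ : R, IsPrimitiveRoot ζ (8 * Fintype.card G)) :
    -- (1) existence of a braiding
    (Nonempty (BraidedCategory C) ↔ NearGroup.IsElementaryTwo G) ∧
    -- (2) if there is one, the classification by the invariants (δ₁, …, δₙ, ε), for all generators
    -- g₁, …, gₙ of G with n the rank of G, and all choices of square roots in R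
    (NearGroup.IsElementaryTwo G →
      ∃ (χ : G → G → R) (τ : R) (σ₁ : BraidedCategory C → G → R) (σ₃ : BraidedCategory C → R),
        (∀ a b, NearGroup.IsChi N a b (χ a b)) ∧ NearGroup.IsTau N τ ∧
        (∀ c a, NearGroup.IsSigmaOne N c a (σ₁ c a)) ∧
        (∀ c, NearGroup.IsSigmaThree N c (σ₃ c)) ∧
        ∀ g : Fin (Group.rank G) → G, Subgroup.closure (Set.range g) = ⊤ →
        ∀ sqrt : R → R, (∀ x, IsSquare x → sqrt x ^ 2 = x) →
          ∃ inv : BraidedCategory C → (Fin (Group.rank G) → ℤˣ) × ℤˣ,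
            (∀ c c', inv c = inv c' ↔ NearGroup.BraidingsEquivalent N c c') ∧
            Function.Surjective inv ∧
            (∀ c, (∀ i, IsSquare (χ (g i) (g i))) ∧ IsSquare (τ * ∑ a, σ₁ c a)) ∧
            ∀ (c : BraidedCategory C) (δ : Fin (Group.rank G) → ℤˣ) (ε : ℤˣ),
              inv c = (δ, ε) ↔
                (∀ i, σ₁ c (g i) = ((δ i : ℤ) : R) * sqrt (χ (g i) (g i))) ∧
                σ₃ c = ((ε : ℤ) : R) * sqrt (τ * ∑ a, σ₁ c a)) ∧
    -- (3) each braiding has exactly two compatible twists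
    (∀ c : BraidedCategory C, Nat.card (NearGroup.Twist c) = 2) := by
  obtain ⟨ζ, hζ⟩ := hR
  have h2 : (2 : R) ≠ 0 := NearGroup.two_ne_zero_of_isPrimitiveRoot Fintype.card_pos hζ
  obtain ⟨V, χ, τ, hχ, hV⟩ := N.exists_normalForm
  obtain ⟨e⟩ := N.unit_iso
  let h : NearGroup.IsSemisimple R N.simple := N.semisimple
  let e' : 𝟙_ C ≅ N.simple (some 1) := e
  have hd := fun c => NearGroup.FusionBasis.isBraidData (h := h) hχ hV c
  have hq : ∀ c, NearGroup.IsQuadratic χ (V.sigmaOne h c) := fun c => ⟨(hd c).sq, (hd c).mul⟩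
  have h₁ : ∀ c a, NearGroup.IsSigmaOne N c a (V.sigmaOne h c a) := fun c a l r hlr =>
    V.sigmaOne_spec h hχ hV e' c a l r hlr
  have h₃ : ∀ c, NearGroup.IsSigmaThree N c (V.sigmaThree h c) := fun c p =>
    V.sigmaThree_spec h e' c p
  have hexists : NearGroup.IsElementaryTwo G → ∀ g : Fin (Group.rank G) → G,
      Subgroup.closure (Set.range g) = ⊤ → ∀ sqrt : R → R, (∀ x, IsSquare x → sqrt x ^ 2 = x) →
      ∀ (δ : Fin (Group.rank G) → ℤˣ) (ε : ℤˣ), ∃ c : BraidedCategory C,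
        (∀ i, V.sigmaOne h c (g i) = ((δ i : ℤ) : R) * sqrt (χ (g i) (g i))) ∧
        V.sigmaThree h c = ((ε : ℤ) : R) * sqrt (τ * ∑ a, V.sigmaOne h c a) := by
    intro hG g hg sqrt hsqrt δ ε
    obtain ⟨σ, hσ, hσg⟩ := hχ.exists_isQuadratic hG g hg
      (fun i => ((δ i : ℤ) : R) * sqrt (χ (g i) (g i))) (fun i => by
        rw [mul_mul_mul_comm, NearGroup.sign_mul_self, one_mul, ← sq,
          hsqrt _ (hχ.isSquare_self hG hζ _)])
    obtain ⟨c, rfl, hc⟩ := NearGroup.FusionBasis.exists_braided (h := h) hχ hV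
      (hσ.isBraidData hχ hG (s := ((ε : ℤ) : R) * sqrt (τ * ∑ a, σ a)) (by
        rw [mul_mul_mul_comm, NearGroup.sign_mul_self, one_mul, ← sq,
          hsqrt _ (hσ.isSquare_gauss hχ hG hζ)]))
    exact ⟨c, hσg, hc⟩
  refine ⟨⟨fun ⟨c⟩ => hχ.isElementaryTwo (hd c).chi_sq, fun hG => ?_⟩, fun hG => ?_,
    NearGroup.FusionBasis.card_twist h2 hχ hV⟩
  · obtain ⟨T, hT, hT'⟩ := Group.rank_spec G
    let g : Fin (Group.rank G) → G := fun i => (T.equivFinOfCardEq hT).symm i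
    have hg : Subgroup.closure (Set.range g) = ⊤ := by
      rw [← hT']
      congr 1
      ext x
      constructor
      · rintro ⟨i, rfl⟩
        exact ((T.equivFinOfCardEq hT).symm i).2
      · intro hx
        exact ⟨T.equivFinOfCardEq hT ⟨x, hx⟩, by simp [g]⟩
    classical
    obtain ⟨c, -⟩ := hexists hG g hg (fun x => if hx : IsSquare x then hx.choose else 0)
      (fun x hx => by rw [dif_pos hx, sq]; exact hx.choose_spec.symm) 1 1
    exact ⟨c⟩
  · refine ⟨χ, τ, V.sigmaOne h, V.sigmaThree h, fun a b l r => V.chi_spec h hV a b l r,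
      fun i p hip => V.tau_spec h hχ hV e' i p hip, h₁, h₃, fun g hg sqrt hsqrt => ?_⟩
    have hsq₁ := hχ.isSquare_self hG hζ
    have hsq₃ : ∀ c, IsSquare (τ * ∑ a, V.sigmaOne h c a) := fun c =>
      (hq c).isSquare_gauss hχ hG hζ
    have hne₁ : ∀ a, sqrt (χ a a) ≠ 0 := fun a ha => by
      have h4 := hsqrt _ (hsq₁ a)
      have h5 := hχ.chi_sq hG a a
      rw [ha] at h4
      rw [← h4] at h5
      simp at h5
    have hne₃ : ∀ c, sqrt (τ * ∑ a, V.sigmaOne h c a) ≠ 0 := fun c hc => by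
      have h4 := hsqrt _ (hsq₃ c)
      obtain ⟨s', hs, -⟩ := (hd c).exists_inverse hχ
      rw [hc, ← (hd c).sq_eq_sum] at h4
      refine left_ne_zero_of_mul_eq_one hs (mul_self_eq_zero.1 ?_)
      rw [← h4]
      simp
    choose δ hδ using fun c i => NearGroup.exists_sign
      (((hd c).sq (g i)).trans (hsqrt _ (hsq₁ (g i))).symm)
    choose ε hε using fun c => NearGroup.exists_sign
      ((hd c).sq_eq_sum.trans (hsqrt _ (hsq₃ c)).symm)
    have hinv : ∀ c δ' ε', (δ c, ε c) = (δ', ε') ↔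
        (∀ i, V.sigmaOne h c (g i) = ((δ' i : ℤ) : R) * sqrt (χ (g i) (g i))) ∧
        V.sigmaThree h c = ((ε' : ℤ) : R) * sqrt (τ * ∑ a, V.sigmaOne h c a) := by
      intro c δ' ε'
      constructor
      · intro hc
        obtain ⟨rfl, rfl⟩ := Prod.mk.inj hc
        exact ⟨hδ c, hε c⟩
      · rintro ⟨h4, h5⟩
        refine Prod.ext (funext fun i => ?_) ?_
        · exact NearGroup.sign_injective h2 (hne₁ (g i)) ((hδ c i).symm.trans (h4 i))
        · exact NearGroup.sign_injective h2 (hne₃ c) ((hε c).symm.trans h5)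
    refine ⟨fun c => (δ c, ε c), fun c c' => ⟨fun hcc => ?_, fun hcc => ?_⟩, ?_,
      fun c => ⟨fun i => hsq₁ (g i), hsq₃ c⟩, hinv⟩
    · -- braidings with the same signs are not only equivalent but equal
      obtain ⟨h4, h5⟩ := (hinv c _ _).1 hcc
      have h6 : V.sigmaOne h c = V.sigmaOne h c' :=
        (hq c).eq_of_closure hχ hG (hq c') hg (by
          rintro _ ⟨i, rfl⟩
          rw [h4, ← hδ])
      rw [h6, ← hε] at h5
      rw [NearGroup.FusionBasis.braided_eq_of_sigma_eq hχ hV h6 h5]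
      exact NearGroup.BraidingsEquivalent.refl N c'
    · have h4 : V.sigmaOne h c' = V.sigmaOne h c := by
        funext a
        have h5 := (h₁ c a).of_equivalent hcc
        refine V.smul_v_injective h (NearGroup.fusion_left (a := a)) ?_
        exact (V.sigmaOne_spec h hχ hV e' c' a _ _
          (V.v_normalized h hχ hV e' a)).symm.trans
          (h5 _ _ (V.v_normalized h hχ hV e' a))
      have h5 : V.sigmaThree h c' = V.sigmaThree h c := by
        have h6 := (h₃ c).of_equivalent hcc
        refine V.smul_v_injective h (NearGroup.fusion_none (a := (1 : G))) ?_
        rw [NearGroup.FusionBasis.sigmaThree, ← V.comp_v h, ← cancel_mono e'.inv, Category.assoc,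
          Linear.smul_comp]
        exact h6 _
      refine (hinv c _ _).2 ⟨fun i => ?_, ?_⟩
      · rw [← h4, hδ]
      · rw [← h5, ← h4, hε]
    · rintro ⟨δ', ε'⟩
      obtain ⟨c, hc⟩ := hexists hG g hg sqrt hsqrt δ' ε'
      exact ⟨c, (hinv c δ' ε').2 hc⟩
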